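/- **Setting.** Let $U:\mathbb R^d\to\mathbb R$ be locally square integrable and periodic with respect to the lattice spanned by a basis $b_1,\dots,b_d$ of $\mathbb R^d$, and suppose that $-\Delta+U$ on $C_c^\infty(\mathbb R^d)$ has a self-adjoint closure $H$. Let $\psi_{nk}$ ($n=0,1,2,\dots$, $k\in\mathbb R^d$) be Bloch eigenfunctions of $-\Delta+U$ with eigenvalues $E_0(k)\le E_1(k)\le\cdots$: they are jointly measurable in $(k,x)$, satisfy $\psi_{nk}(x+b_i)=e^{-ik\cdot b_i}\psi_{nk}(x)$ and $(-\Delta+U)\psi_{nk}=E_n(k)\psi_{nk}$ in the sense of distributions, and for each $k$ the family $(\psi_{nk})_n$ is complete and orthogonal in $L^2$ of the unit cell, with squared norms equal to a constant independent of $n,k$. Consider Bose or Fermi fields $a(x),a^*(x)$ over $L^2(\mathbb R^d)$ satisfying the canonical (anti)commutation relations, the quasi-free time evolution $\alpha_t(a(x))=(e^{-itH}a)(x)$, and the band fields (generalized Fourier transform) $\tilde a(k,n)=\int\psi_{nk}(x)\,a(x)\,dx$. Let $(\omega^\varepsilon)_{\varepsilon>0}$ be states. Fix a band $n$, an open set $\Omega\subseteq\mathbb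 R^d$ of quasi-momenta on which $E_n$ is $C^\infty$, and an exponent $s\in\{0,1,2,\dots\}$. For a family of states $(\omega^\varepsilon)$ we say that the band distribution function $$f_n(r,k)=\lim_{\varepsilon\downarrow0}\varepsilon^{s}\int_{\mathbb R^d}dv\,e^{-ir\cdot v}\,\omega^\varepsilon\big[\tilde a^*(k+\tfrac{\varepsilon v}2,n)\,\tilde a(k-\tfrac{\varepsilon v}2,n)\big],\qquad r\in\mathbb R^d,\ k\in\Omega,$$ exists if the two-point functions $\omega^\varepsilon[\tilde a^*(p,n)\tilde a(q,n)]$ are distributions on $\Omega\times\Omega$ and the limit exists in the sense of distributions, i.e. after pairing with every $\varphi(r,k)$ whose Fourier transform in $r$ belongs to $C_c^\infty(\mathbb R^d\times\Omega)$. The limit is then a linear functional on such test functions $\varphi$. **Statement.** If the band distribution function $f_n$ of $(\omega^\varepsilon)$ exists, then for every $t\in\mathbb R$ the band distribution function $f_n(\cdot,\cdot\,;t)$ of the time-evolved states $\omega^\varepsilon\circ\alpha_{\varepsilon^{-1}t}$ exists, in the same sense. It satisfies $f_n(\cdot,\cdot\,;0)=f_n$ and $$f_n(r,k;t)=f_n\big(r-t\,\partial_kE_n(k),\,k\big),\quad\text{i.e.}\quad\langle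 f_n(t),\varphi\rangle=\langle f_n,\varphi(r+t\,\partial_kE_n(k),k)\rangle,$$ and it solves $$\partial_tf_n(r,k;t)+\partial_kE_n(k)\cdot\partial_rf_n(r,k;t)=0$$ in the sense that $\frac{d}{dt}\langle f_n(t),\varphi\rangle=\langle f_n(t),\partial_kE_n(k)\cdot\partial_r\varphi\rangle$ for all $t$ and all test functions $\varphi$. If $f_n$ is given by a function $f_n(r,k)$ whose product with every test function is integrable, then $f_n(\cdot,\cdot\,;t)$ is given in the same way by the function $f_n(r-t\,\partial_kE_n(k),k)$; and for every $k\in\Omega$ for which $f_n(\cdot,k)$ is differentiable on $\mathbb R^d$, this function satisfies the equation pointwise, for all $t$ and $r$. -/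

import Mathlib

open MeasureTheory Filter Topology
open scoped ContDiff Laplacian Gradient Distributions ComplexConjugate

noncomputable section

namespace BlochEuler

/-- Physical space `ℝ^d`, also used for quasi-momenta. -/
abbrev Sp (d : ℕ) : Type := EuclideanSpace ℝ (Fin d)

/-- The one-particle space `L²(ℝ^d)`. -/
abbrev OneParticle (d : ℕ) : Type := Lp ℂ 2 (volume : Measure (Sp d))

/-- The open set `Ω₁ × Ω₂`. -/
def box {X Y : Type*} [TopologicalSpace X] [TopologicalSpace Y] (Ω₁ : TopologicalSpace.Opens X)
    (Ω₂ : TopologicalSpace.Opens Y) : TopologicalSpace.Opens (X × Y) :=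
  ⟨(Ω₁ : Set X) ×ˢ (Ω₂ : Set Y), Ω₁.isOpen.prod Ω₂.isOpen⟩

/-! ### The one-particle Hamiltonian and its unitary group -/

/-- A real potential, locally square integrable and periodic for the lattice spanned by `b`. -/
structure IsPeriodicPotential {d : ℕ} (b : Module.Basis (Fin d) ℝ (Sp d)) (U : Sp d → ℝ) :
    Prop where
  measurable : Measurable U
  locallyL2 : LocallyIntegrable (fun x => U x ^ 2) volume
  periodic : ∀ i x, U (x + b i) = U x

/-- The function `-Δχ + Uχ`. -/
def schrodinger {d : ℕ} (U : Sp d → ℝ) (χ : Sp d → ℂ) : Sp d → ℂ :=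
  fun x => -(Δ χ) x + (U x : ℂ) * χ x

/-- The graph of `-Δ + U` on smooth compactly supported functions, inside `L² × L²`. -/
def schrodingerGraph {d : ℕ} (U : Sp d → ℝ) : Set (OneParticle d × OneParticle d) :=
  {p | ∃ χ : Sp d → ℂ, ContDiff ℝ ∞ χ ∧ HasCompactSupport χ ∧
    p.1 =ᵐ[volume] χ ∧ p.2 =ᵐ[volume] schrodinger U χ}

/-- `V t = exp(itH)`, where the self-adjoint operator `H` is the closure of `-Δ + U` on smooth
compactly supported functions: `V` is a strongly continuous one-parameter unitary group, and
`t ↦ V t f` has derivative `i g` at `0` exactly when `(f, g)` is in the graph of that closure. -/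
structure IsSchrodingerGroup {d : ℕ} (U : Sp d → ℝ)
    (V : ℝ → (OneParticle d ≃ₗᵢ[ℂ] OneParticle d)) : Prop where
  zero : ∀ f, V 0 f = f
  add : ∀ s t f, V (s + t) f = V s (V t f)
  continuous : ∀ f, Continuous fun t => V t f
  generator : ∀ f g, HasDerivAt (fun t => V t f) (Complex.I • g) 0 ↔
    (f, g) ∈ closure (schrodingerGraph U)

/-! ### Bloch functions and bands -/

/-- `ψ n k` (`n = 0, 1, …`, `k ∈ ℝ^d`) are Bloch eigenfunctions of `-Δ + U` with eigenvalues
`E n k`. For each `k` they form a complete orthogonal system in `L²` of the unit cell, of common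
squared norm `N`, made of functions with quasi-momentum `k` that solve `(-Δ + U)ψ = Eψ` in the sense
of distributions; the eigenvalues are numbered in nondecreasing order. The sign of the quasi-momentum
is such that `exp(-i k·x)` is the Bloch function of a free particle. -/
structure IsBlochSystem {d : ℕ} (b : Module.Basis (Fin d) ℝ (Sp d)) (U : Sp d → ℝ) (N : ℝ)
    (ψ : ℕ → Sp d → Sp d → ℂ) (E : ℕ → Sp d → ℝ) : Prop where
  norm_pos : 0 < N
  measurable : ∀ n, Measurable (Function.uncurry (ψ n))
  quasiperiodic : ∀ n k i x,
    ψ n k (x + b i) = Complex.exp (-Complex.I * (inner ℝ k (b i) : ℝ)) * ψ n k x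
  orthogonal : ∀ k m n, ∫ x in ZSpan.fundamentalDomain b, conj (ψ m k x) * ψ n k x =
    if m = n then (N : ℂ) else 0
  complete : ∀ k (u : Sp d → ℂ), MemLp u 2 (volume.restrict (ZSpan.fundamentalDomain b)) →
    (∀ n, ∫ x in ZSpan.fundamentalDomain b, conj (ψ n k x) * u x = 0) →
    u =ᵐ[volume.restrict (ZSpan.fundamentalDomain b)] 0
  eigen : ∀ n k (χ : Sp d → ℂ), ContDiff ℝ ∞ χ → HasCompactSupport χ →
    ∫ x, ψ n k x * schrodinger U χ x = (E n k : ℂ) * ∫ x, ψ n k x * χ x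
  ordered : ∀ k, Monotone fun n => E n k

/-! ### Fields, states and quasi-free dynamics -/

/-- `f ↦ a f` (formally `a f = ∫ conj (f x) a(x) dx`) are annihilation operators over `L²(ℝ^d)` in
the unital `*`-algebra `A`: antilinear, and satisfying the canonical commutation relations for
`σ = 1` (bosons), the canonical anticommutation relations for `σ = -1` (fermions). -/
structure IsCanonicalField {d : ℕ} {A : Type*} [Ring A] [StarRing A] [Algebra ℂ A]
    (σ : ℤˣ) (a : OneParticle d → A) : Prop where
  map_add : ∀ f g, a (f + g) = a f + a g
  map_smul : ∀ (c : ℂ) f, a (c • f) = conj c • a f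
  annihilate : ∀ f g, a f * a g - ((σ : ℤ) : ℂ) • (a g * a f) = 0
  canonical : ∀ f g, a f * star (a g) - ((σ : ℤ) : ℂ) • (star (a g) * a f) =
    algebraMap ℂ A (inner ℂ f g)

/-- A state: a normalized positive linear functional. -/
structure IsState {A : Type*} [Ring A] [StarRing A] [Algebra ℂ A] (ρ : A →ₗ[ℂ] ℂ) : Prop where
  map_one : ρ 1 = 1
  nonneg_re : ∀ x, 0 ≤ (ρ (star x * x)).re
  im_zero : ∀ x, (ρ (star x * x)).im = 0

/-- `α t` is the quasi-free (Heisenberg) time evolution `α_t(a(f)) = a(exp(itH) f)` of the fields,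
where `V t = exp(itH)`; equivalently `α_t(a(x)) = (exp(-itH) a)(x)`. -/
def IsQuasiFreeEvolution {d : ℕ} {A : Type*} [Ring A] [StarRing A] [Algebra ℂ A]
    (a : OneParticle d → A) (V : ℝ → (OneParticle d ≃ₗᵢ[ℂ] OneParticle d))
    (α : ℝ → (A ≃⋆ₐ[ℂ] A)) : Prop :=
  ∀ t f, α t (a f) = a (V t f)

/-! ### Band fields and their two-point distribution -/

open Classical in
/-- The wave packet `x ↦ ∫ conj (g k ψ_k(x)) dk` as an element of `L²(ℝ^d)`. -/
def bandPacket {d : ℕ} (ψ : Sp d → Sp d → ℂ) (g : Sp d → ℂ) : OneParticle d :=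
  if h : MemLp (fun x => ∫ k, conj (g k * ψ k x)) 2 (volume : Measure (Sp d)) then h.toLp _ else 0

/-- The smeared band annihilation operator `∫ g(k) ã(k) dk`, with `ã(k) = ∫ ψ_k(x) a(x) dx` the
generalized Fourier transform of the field. -/
def bandField {d : ℕ} {A : Type*} (a : OneParticle d → A) (ψ : Sp d → Sp d → ℂ)
    (g : Sp d → ℂ) : A :=
  a (bandPacket ψ g)

/-- `K` is the two-point function `(p, q) ↦ ρ[ã*(p) ã(q)]` as a distribution on `Ω × Ω`. -/
def IsTwoPoint {d : ℕ} {A : Type*} [Ring A] [StarRing A]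
    (a : OneParticle d → A) (ψ : Sp d → Sp d → ℂ) (Ω : TopologicalSpace.Opens (Sp d))
    (ρ : A → ℂ) (K : 𝓓(box Ω Ω, ℂ) →L[ℂ] ℂ) : Prop :=
  ∀ (g h : 𝓓(Ω, ℂ)) (Φ : 𝓓(box Ω Ω, ℂ)), (∀ p q, Φ (p, q) = conj (g p) * h q) →
    K Φ = ρ (star (bandField a ψ g) * bandField a ψ h)

open Classical in
/-- Evaluation of a distribution on `W` at a function (`0` unless it is a test function on `W`). -/
def evalOn {X : Type*} [NormedAddCommGroup X] [NormedSpace ℝ X] {W : TopologicalSpace.Opens X}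
    (K : 𝓓(W, ℂ) →L[ℂ] ℂ) (F : X → ℂ) : ℂ :=
  if h : ContDiff ℝ ∞ F ∧ HasCompactSupport F ∧ tsupport F ⊆ W then K ⟨F, h.1, h.2.1, h.2.2⟩ else 0

/-! ### Band distribution functions -/

/-- Test functions `φ(r, k)` on phase space `ℝ^d × Ω`: those whose Fourier transform in `r` is a
smooth compactly supported function on `ℝ^d × Ω`. -/
def IsPhaseTest {d : ℕ} (Ω : TopologicalSpace.Opens (Sp d)) (φ : Sp d → Sp d → ℂ) : Prop :=
  ∃ Φ : 𝓓(box (⊤ : TopologicalSpace.Opens (Sp d)) Ω, ℂ), ∀ r k,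
    φ r k = (((2 * Real.pi : ℝ) : ℂ) ^ d)⁻¹ *
      ∫ v, Complex.exp (Complex.I * (inner ℝ r v : ℝ)) * Φ (v, k)

/-- The Fourier transform in the position variable, `∫ exp(-i r·v) φ(r, k) dr`. -/
def positionFourier {d : ℕ} (φ : Sp d → Sp d → ℂ) (v k : Sp d) : ℂ :=
  ∫ r, Complex.exp (-Complex.I * (inner ℝ r v : ℝ)) * φ r k

/-- The pairing with `φ` of the rescaled distribution
`f^ε(r, k) = ε^s ∫ exp(-i r·v) K(k + εv/2, k - εv/2) dv`, that is,
`∫∫ f^ε φ dr dk = ε^s ∫∫ K(k + εv/2, k - εv/2) φ̂(v, k) dv dk`, in the variables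
`p = k + εv/2`, `q = k - εv/2`, for which `dv dk = ε^(-d) dp dq`. -/
def bandPairing {d : ℕ} {Ω : TopologicalSpace.Opens (Sp d)} (s : ℕ)
    (K : 𝓓(box Ω Ω, ℂ) →L[ℂ] ℂ) (ε : ℝ) (φ : Sp d → Sp d → ℂ) : ℂ :=
  (ε : ℂ) ^ s * evalOn K fun pq =>
    ((ε : ℂ) ^ d)⁻¹ *
      positionFourier φ (ε⁻¹ • (pq.1 - pq.2)) ((2 : ℝ)⁻¹ • (pq.1 + pq.2))

/-- The family `ρ ε` has, as `ε ↓ 0`, a band distribution function on `ℝ^d × Ω` for the Bloch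
functions `ψ`, namely `f`, given by its values `f φ = ∫∫ f(r, k) φ(r, k) dr dk` on test functions. -/
def IsBandDistribution {d : ℕ} {A : Type*} [Ring A] [StarRing A]
    (a : OneParticle d → A) (ψ : Sp d → Sp d → ℂ) (Ω : TopologicalSpace.Opens (Sp d)) (s : ℕ)
    (ρ : ℝ → A → ℂ) (f : (Sp d → Sp d → ℂ) → ℂ) : Prop :=
  ∃ K : ℝ → (𝓓(box Ω Ω, ℂ) →L[ℂ] ℂ), (∀ ε, 0 < ε → IsTwoPoint a ψ Ω (ρ ε) (K ε)) ∧
    ∀ φ, IsPhaseTest Ω φ → Tendsto (fun ε => bandPairing s (K ε) ε φ) (𝓝[>] 0) (𝓝 (f φ))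

/-- `f` is given by the function `u(r, k)`. -/
def IsGivenBy {d : ℕ} (Ω : TopologicalSpace.Opens (Sp d)) (f : (Sp d → Sp d → ℂ) → ℂ)
    (u : Sp d → Sp d → ℂ) : Prop :=
  ∀ φ, IsPhaseTest Ω φ →
    Integrable (fun z : Sp d × Sp d => u z.1 z.2 * φ z.1 z.2) ∧
    f φ = ∫ z : Sp d × Sp d, u z.1 z.2 * φ z.1 z.2

end BlochEuler

end

/-! On packets built from band `n` with smearing function `g` supported in `Ω`, `exp(itH)`
multiplies `g` by `exp(-itE)` (`IsBlochSystem.map_bandPacket`). At time `τ` the two-point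
distribution is therefore `K` times `exp(iτ(E(p) - E(q)))`. For `τ = t/ε` and `p, q = k ± εv/2` this
phase is `exp(it(E(k + εv/2) - E(k - εv/2))/ε)`. It is smooth in `(ε, v, k)` down to `ε = 0`, where
it equals `exp(it v·∇E(k))`, and multiplying by the latter in the Fourier variable `v` is
translating `r` by `t∇E(k)`.

Two points need analysis. The limit is assumed only for fixed test functions, whereas the phase
makes them depend on `ε`. The functions supported in a fixed compact set form a Fréchet space, so
Banach–Steinhaus makes the functionals equicontinuous along sequences and both limits can be taken
together (`tendsto_apply_of_tendsto_pointwise`, `tendsto_bandPairing_transport`). It also makes `f`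
continuous, which gives the transport equation by differentiating a smooth family of test functions
(`hasDerivAt_transport`).

The other point is the action of `H` on packets, with Bloch functions only measurable in `k`. The
values of a packet at the lattice translates of a point are Fourier coefficients, so Bessel's
inequality bounds its `L²` norm (`IsBand.exists_lintegral_packet_le`). The packet with phase is then
a differentiable curve solving the Schrödinger equation weakly, and pairing it with evolved test
functions identifies it with the unitary orbit (`IsSchrodingerGroup.eq_of_hasDerivAt`). -/

noncomputable section

namespace BlochEuler

/-! ### Smooth functions supported in a compact set form a Fréchet space -/

section Frechet

variable {X : Type*} [NormedAddCommGroup X] [NormedSpace ℝ X]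
  {F : Type*} [NormedAddCommGroup F] [NormedSpace ℝ F]
  {L : TopologicalSpace.Compacts X}

-- The maps `f ↦ iteratedFDeriv ℝ i f` embed the space in a countable product of spaces of bounded
-- continuous functions. The range is closed because a uniform limit of all derivatives is the
-- Taylor series of its term of order zero.
open BoundedContinuousFunction in
instance completeSpace_contDiffMapSupportedIn [CompleteSpace F] : CompleteSpace 𝓓_{L}(X, F) := by
  have hemb := ContDiffMapSupportedIn.isUniformEmbedding_pi_structureMapCLM (n := ⊤) (E := X)
    (F := F) (K := L) ℝ
  refine (completeSpace_iff_isComplete_range hemb.isUniformInducing).2 ?_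
  refine IsClosed.isComplete (isClosed_of_closure_subset fun g hg => ?_)
  obtain ⟨y, hy, hlim⟩ := mem_closure_iff_seq_limit.1 hg
  choose f hf using hy
  have hfi : ∀ i, TendstoUniformly (fun j x => iteratedFDeriv ℝ i (f j) x) (fun x => g i x)
      atTop := by
    intro i
    have h1 : Tendsto (fun j => y j i) atTop (𝓝 (g i)) := (tendsto_pi_nhds.1 hlim) i
    have h2 := tendsto_iff_tendstoUniformly.1 h1
    have h3 : ∀ j, (y j i : X → _) = fun x => iteratedFDeriv ℝ i (f j) x := by
      intro j
      rw [← hf j]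
      exact ContDiffMapSupportedIn.structureMapCLM_top_apply ℝ (f j)
    simpa only [h3] using! h2
  let f₀ : X → F := fun x => (g 0 x).curry0
  let p : X → FormalMultilinearSeries ℝ X F := fun x i => g i x
  have htaylor : HasFTaylorSeriesUpTo ∞ f₀ p := by
    refine ⟨fun x => rfl, fun m _ x => ?_, fun m _ => (g m).continuous⟩
    have hu : TendstoUniformly (fun j x => (iteratedFDeriv ℝ (m + 1) (f j) x).curryLeft)
        (fun x => (g (m + 1) x).curryLeft) atTop :=
      (continuousMultilinearCurryLeftEquiv ℝ (fun _ : Fin (m + 1) => X)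
        F).isometry.uniformContinuous.comp_tendstoUniformly (hfi (m + 1))
    refine hasFDerivAt_of_tendstoUniformly (f := fun j x => iteratedFDeriv ℝ m (f j) x) hu
      (fun j x => ?_) (fun x => (hfi m).tendsto_at x) x
    have hd : DifferentiableAt ℝ (iteratedFDeriv ℝ m (f j)) x :=
      ((f j).contDiff.differentiable_iteratedFDeriv
        (WithTop.coe_lt_coe.2 (WithTop.coe_lt_top m))) x
    have := hd.hasFDerivAt
    rwa [fderiv_iteratedFDeriv] at this
  have hsupp : Set.EqOn f₀ 0 (L : Set X)ᶜ := by
    intro x hx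
    have h1 := (hfi 0).tendsto_at x
    have h2 : ∀ j, iteratedFDeriv ℝ 0 (f j) x = 0 := fun j =>
      (f j).iteratedFDeriv_zero_on_compl hx
    simp only [h2] at h1
    have h3 : g 0 x = 0 := tendsto_nhds_unique h1 tendsto_const_nhds
    simp [f₀, h3]
  refine ⟨⟨f₀, htaylor.contDiff, hsupp⟩, ?_⟩
  ext i x : 2
  have : (ContDiffMapSupportedIn.structureMapCLM ℝ ⊤ i
      (⟨f₀, htaylor.contDiff, hsupp⟩ : 𝓓_{L}(X, F)) : X → _) = iteratedFDeriv ℝ i f₀ :=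
    ContDiffMapSupportedIn.structureMapCLM_top_apply ℝ _
  refine (congrFun this x).trans ?_
  exact (htaylor.eq_iteratedFDeriv (mod_cast le_top) x).symm

/-- With completeness this makes the space Baire, hence barrelled, as Banach–Steinhaus requires. -/
instance isCountablyGenerated_uniformity_contDiffMapSupportedIn :
    (uniformity 𝓓_{L}(X, F)).IsCountablyGenerated := by
  have hemb := ContDiffMapSupportedIn.isUniformEmbedding_pi_structureMapCLM (n := ⊤) (E := X)
    (F := F) (K := L) ℝ
  rw [← hemb.isUniformInducing.comap_uniformity]
  infer_instance

instance baireSpace_contDiffMapSupportedIn [CompleteSpace F] : BaireSpace 𝓓_{L}(X, F) := by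
  infer_instance

end Frechet

/-- A pointwise convergent family of continuous functionals on a barrelled space can be evaluated
along a convergent family of vectors. -/
theorem tendsto_apply_of_tendsto_pointwise {α X : Type*} [AddCommGroup X] [Module ℂ X]
    [UniformSpace X] [IsUniformAddGroup X] [ContinuousSMul ℂ X] [BarrelledSpace ℂ X]
    {l : Filter α} [l.IsCountablyGenerated] {T : α → X →L[ℂ] ℂ} {T₀ : X → ℂ}
    (hT : ∀ x, Tendsto (fun a => T a x) l (𝓝 (T₀ x))) {x : α → X} {x₀ : X}
    (hx : Tendsto x l (𝓝 x₀)) : Tendsto (fun a => T a (x a)) l (𝓝 (T₀ x₀)) := by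
  -- A family that converges along a filter need not be bounded, but a convergent sequence is;
  -- Banach–Steinhaus needs pointwise bounds.
  refine tendsto_of_seq_tendsto fun u hu => ?_
  have heq : UniformEquicontinuous fun j => (T (u j) : X → ℂ) := by
    refine (norm_withSeminorms ℂ ℂ).banach_steinhaus (𝓕 := fun j => T (u j)) fun _ y => ?_
    simpa using! (((hT y).comp hu).norm).bddAbove_range
  have h1 : Tendsto (fun j => T (u j) (x (u j)) - T (u j) x₀) atTop (𝓝 0) := by
    have hd := heq.equicontinuous x₀
    rw [Metric.tendsto_nhds]
    intro ε hε
    have h2 := Metric.equicontinuousAt_iff_right.1 hd ε hε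
    filter_upwards [(hx.comp hu).eventually h2] with j hj
    have := hj j
    rw [dist_comm, dist_eq_norm] at this
    simpa [dist_eq_norm] using this
  simpa using! h1.add ((hT x₀).comp hu)

/-! ### Cutoffs, multiplication and linear changes of variables -/

section TestOps

variable {X : Type*} [NormedAddCommGroup X] [NormedSpace ℝ X]

/-- Multiply by a cutoff equal to 1 near `L`. Agreement on a neighbourhood of `L`, not only on `L`,
lets derivatives at points of `L` be compared too. -/
theorem exists_contDiff_eventuallyEq_of_isCompact [FiniteDimensional ℝ X] {F : Type*} [NormedAddCommGroup F]
    [NormedSpace ℝ F] {Ω : Set X} (hΩ : IsOpen Ω) {m : X → F} (hm : ContDiffOn ℝ ∞ m Ω) {L : Set X}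
    (hL : IsCompact L) (hLΩ : L ⊆ Ω) :
    ∃ m' : X → F, ContDiff ℝ ∞ m' ∧ ∀ᶠ x in 𝓝ˢ L, m' x = m x := by
  obtain ⟨L', hL', hLL', hL'Ω⟩ := exists_compact_between hL hΩ hLΩ
  obtain ⟨χ, h1, h2, -⟩ := exists_contMDiffMap_one_nhds_of_subset_interior (n := ⊤)
    (modelWithCornersSelf ℝ X) hL.isClosed hLL'
  have hχ : ContDiff ℝ ∞ χ := χ.contMDiff.contDiff
  refine ⟨fun x => χ x • m x, ?_, h1.mono fun x hx => by simp [hx]⟩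
  rw [contDiff_iff_contDiffAt]
  intro x
  by_cases hx : x ∈ L'
  · exact hχ.contDiffAt.smul (hm.contDiffAt (hΩ.mem_nhds (hL'Ω hx)))
  · refine (contDiffAt_const (c := (0 : F))).congr_of_eventuallyEq ?_
    filter_upwards [hL'.isClosed.isOpen_compl.mem_nhds hx] with y hy
    simp [h2 y hy]

/-- Multiplication of smooth functions supported in `L` by a function smooth near `L`. -/
theorem exists_mulCLM [FiniteDimensional ℝ X] {Ω : Set X} (hΩ : IsOpen Ω) {m : X → ℂ} (hm : ContDiffOn ℝ ∞ m Ω)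
    (L : TopologicalSpace.Compacts X) (hLΩ : (L : Set X) ⊆ Ω) :
    ∃ T : 𝓓_{L}(X, ℂ) →L[ℂ] 𝓓_{L}(X, ℂ), ∀ f x, T f x = m x * f x := by
  obtain ⟨m', hm', he⟩ := exists_contDiff_eventuallyEq_of_isCompact hΩ hm L.isCompact hLΩ
  refine ⟨ContDiffMapSupportedIn.bilinLeftCLM (n := ⊤) (ContinuousLinearMap.mul ℂ ℂ) hm',
    fun f x => ?_⟩
  simp only [ContDiffMapSupportedIn.bilinLeftCLM_apply, ContinuousLinearMap.mul_apply']
  show f x * m' x = _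
  by_cases hx : x ∈ (L : Set X)
  · rw [he.self_of_nhdsSet x hx, mul_comm]
  · simp [f.zero_on_compl hx]

/-- The product of a test function on `Ω` and a function smooth on `Ω`. -/
def mulTest {Ω : TopologicalSpace.Opens X} {m : X → ℂ} (hm : ContDiffOn ℝ ∞ m Ω) (f : 𝓓(Ω, ℂ)) :
    𝓓(Ω, ℂ) where
  toFun x := m x * f x
  contDiff' := by
    rw [contDiff_iff_contDiffAt]
    intro x
    by_cases hx : x ∈ tsupport f
    · exact (hm.contDiffAt (Ω.isOpen.mem_nhds (f.tsupport_subset hx))).mul f.contDiff.contDiffAt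
    · refine (contDiffAt_const (c := (0 : ℂ))).congr_of_eventuallyEq ?_
      filter_upwards [(isClosed_tsupport f).isOpen_compl.mem_nhds hx] with y hy
      simp [image_eq_zero_of_notMem_tsupport hy]
  hasCompactSupport' := f.hasCompactSupport.mul_left
  tsupport_subset' := (tsupport_mul_subset_right).trans f.tsupport_subset

@[simp]
theorem mulTest_apply {Ω : TopologicalSpace.Opens X} {m : X → ℂ} (hm : ContDiffOn ℝ ∞ m Ω)
    (f : 𝓓(Ω, ℂ)) (x : X) : mulTest hm f x = m x * f x := rfl

/-- The distribution `m K`, for `m` smooth on `Ω`. -/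
theorem exists_mul_distribution [FiniteDimensional ℝ X] {Ω : TopologicalSpace.Opens X} {m : X → ℂ}
    (hm : ContDiffOn ℝ ∞ m Ω) (K : 𝓓(Ω, ℂ) →L[ℂ] ℂ) :
    ∃ K' : 𝓓(Ω, ℂ) →L[ℂ] ℂ, ∀ f, K' f = K (mulTest hm f) := by
  choose T hT using fun (L : TopologicalSpace.Compacts X) (hL : (L : Set X) ⊆ Ω) =>
    exists_mulCLM Ω.isOpen hm L hL
  -- Continuity is tested on functions supported in one compact `L` at a time, where `m` may be
  -- replaced by a globally smooth function.
  refine ⟨TestFunction.limitCLM ℂ (fun f => K (mulTest hm f))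
    (fun L hL => K ∘L (TestFunction.ofSupportedInCLM ℂ hL) ∘L (T L hL)) fun L hL f => ?_,
    fun f => rfl⟩
  show K _ = K _
  congr 1
  ext x
  exact (hT L hL f x).symm

/-- Composition with a linear map, on smooth functions supported in a compact set. -/
theorem exists_compCLM {Y : Type*} [NormedAddCommGroup Y] [NormedSpace ℝ Y]
    (A : X →L[ℝ] Y) (L : TopologicalSpace.Compacts Y) (L' : TopologicalSpace.Compacts X)
    (hL : ∀ x, A x ∈ L → x ∈ L') :
    ∃ T : 𝓓_{L}(Y, ℂ) →L[ℂ] 𝓓_{L'}(X, ℂ), ∀ f x, T f x = f (A x) := by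
  let T : 𝓓_{L}(Y, ℂ) →ₗ[ℂ] 𝓓_{L'}(X, ℂ) :=
    { toFun f := ⟨fun x => f (A x), f.contDiff.comp A.contDiff,
        fun x hx => f.zero_on_compl fun h => hx (hL x h)⟩
      map_add' f g := rfl
      map_smul' c f := rfl }
  refine ⟨⟨T, ?_⟩, fun _ _ => rfl⟩
  refine WithSeminorms.continuous_of_isBounded (ContDiffMapSupportedIn.withSeminorms ℂ Y ℂ ⊤ L)
    (ContDiffMapSupportedIn.withSeminorms ℂ X ℂ ⊤ L') T (.of_real fun i => ?_)
  refine ⟨{i}, ‖A‖ ^ i, fun f => ?_⟩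
  refine ((T f).seminorm_top_le_iff ℂ (mul_nonneg (by positivity) (apply_nonneg _ _)) i).2
    fun x _ => ?_
  have h1 := A.iteratedFDeriv_comp_right (f := f) f.contDiff x (i := i) (mod_cast le_top)
  rw [show (T f : X → ℂ) = f ∘ A from rfl, h1]
  refine (ContinuousMultilinearMap.norm_compContinuousLinearMap_le _ _).trans ?_
  rw [Finset.prod_const, Finset.card_univ, Fintype.card_fin, mul_comm, Finset.sup_singleton]
  gcongr
  exact ContDiffMapSupportedIn.norm_iteratedFDeriv_apply_le_seminorm_top ℂ

end TestOps

/-! ### Smooth one-parameter families of test functions -/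

section Families

variable {X : Type*} [NormedAddCommGroup X] [NormedSpace ℝ X]

/-- The integral is the value at 0 of the convolution of the indicator of `[0, 1]` with `y ↦ χ y • D
(-y, z)`. The bump `χ` is 1 on `[-1, 1]`, so it changes nothing there and supplies compact support.
-/
theorem contDiff_integral_Icc {F : Type*} [NormedAddCommGroup F] [NormedSpace ℝ F]
    [CompleteSpace F] {D : ℝ × X → F} (hD : ContDiff ℝ ∞ D) :
    ContDiff ℝ ∞ fun z : X => ∫ τ in Set.Icc (0 : ℝ) 1, D (τ, z) := by
  let χ : ContDiffBump (0 : ℝ) := ⟨1, 2, one_pos, one_lt_two⟩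
  let g : X → ℝ → F := fun z y => χ y • D (-y, z)
  have hg : ContDiff ℝ ∞ ↿g := by
    have h1 : ContDiff ℝ ∞ (χ : ℝ → ℝ) := χ.contDiff
    have h2 : ContDiff ℝ ∞ fun q : X × ℝ => D (-q.2, q.1) :=
      hD.comp (contDiff_snd.neg.prodMk contDiff_fst)
    exact (h1.comp contDiff_snd).smul h2
  have hf : LocallyIntegrable ((Set.Icc (0 : ℝ) 1).indicator fun _ => (1 : ℝ)) volume :=
    (integrable_indicator_iff measurableSet_Icc).2
      (integrableOn_const (by simp)) |>.locallyIntegrable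
  have hconv := contDiffOn_convolution_right_with_param_comp (n := ⊤) (μ := volume)
    (ContinuousLinearMap.lsmul ℝ ℝ : ℝ →L[ℝ] F →L[ℝ] F) (v := fun _ : X => (0 : ℝ))
    (s := Set.univ) contDiffOn_const (g := g) isOpen_univ (isCompact_closedBall (0 : ℝ) 2)
    (fun p x _ hx => by
      have : χ x = 0 := χ.zero_of_le_dist (by
        rw [Metric.mem_closedBall, not_le] at hx
        exact hx.le)
      simp [g, this]) hf hg.contDiffOn
  rw [contDiffOn_univ] at hconv
  convert hconv using 1
  funext z
  rw [MeasureTheory.convolution_def, ← integral_indicator measurableSet_Icc]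
  refine integral_congr_ae (Eventually.of_forall fun τ => ?_)
  by_cases hτ : τ ∈ Set.Icc (0 : ℝ) 1
  · have : χ (0 - τ) = 1 := χ.one_of_mem_closedBall (by
      simpa [abs_le] using ⟨by linarith [hτ.1], hτ.2⟩)
    simp only [Set.indicator_of_mem hτ, ContinuousLinearMap.lsmul_apply, one_smul, g, this]
    simp
  · simp [Set.indicator_of_notMem hτ]

/-- Hadamard's lemma. -/
theorem exists_contDiff_difference_quotient {F : Type*} [NormedAddCommGroup F] [NormedSpace ℝ F]
    [CompleteSpace F] {W : ℝ × X → F} (hW : ContDiff ℝ ∞ W) :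
    ∃ G : ℝ × X → F, ContDiff ℝ ∞ G ∧ (∀ h x, W (h, x) - W (0, x) = h • G (h, x)) ∧
      ∀ x, HasDerivAt (fun h => W (h, x)) (G (0, x)) 0 := by
  let D : ℝ × X → F := fun z => fderiv ℝ W z (1, 0)
  have hD : ContDiff ℝ ∞ D :=
    (hW.fderiv_right (m := ∞) (by simp)).clm_apply contDiff_const
  have hDW : ∀ h x, HasDerivAt (fun h => W (h, x)) (D (h, x)) h := by
    intro h x
    have h1 : HasDerivAt (fun h : ℝ => (h, x)) ((1 : ℝ), (0 : X)) h :=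
      (hasDerivAt_id h).prodMk (hasDerivAt_const h x)
    exact ((hW.differentiable (by simp)) (h, x)).hasFDerivAt.comp_hasDerivAt h h1
  -- The quotient is the mean of `∂W/∂h` over the segment from `(0, x)` to `(h, x)`.
  refine ⟨fun z => ∫ τ in Set.Icc (0 : ℝ) 1, D (τ * z.1, z.2), ?_, fun h x => ?_, fun x => ?_⟩
  · exact contDiff_integral_Icc (D := fun q : ℝ × ℝ × X => D (q.1 * q.2.1, q.2.2))
      (hD.comp ((contDiff_fst.mul (contDiff_fst.comp contDiff_snd)).prodMk
        (contDiff_snd.comp contDiff_snd)))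
  · have h1 : ∀ τ ∈ Set.uIcc (0 : ℝ) 1,
        HasDerivAt (fun τ => W (τ * h, x)) (h • D (τ * h, x)) τ := by
      intro τ _
      have := (hDW (τ * h) x).scomp τ ((hasDerivAt_id τ).mul_const h)
      simpa using! this
    have h2 := intervalIntegral.integral_eq_sub_of_hasDerivAt h1
      (Continuous.intervalIntegrable (by
        have := hD.continuous
        fun_prop) _ _)
    simp only [one_mul, zero_mul] at h2
    rw [← h2, intervalIntegral.integral_smul, intervalIntegral.integral_of_le zero_le_one,
      ← integral_Icc_eq_integral_Ioc]
  · have := hDW 0 x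
    simpa using this

variable {L : TopologicalSpace.Compacts X}

/-- The member of index `h` of a smooth family of functions supported in `L`. -/
def slice {W : ℝ × X → ℂ} (hW : ContDiff ℝ ∞ W) (hL : ∀ h, ∀ x ∉ L, W (h, x) = 0) (h : ℝ) :
    𝓓_{L}(X, ℂ) where
  toFun x := W (h, x)
  contDiff' := hW.comp (contDiff_const.prodMk contDiff_id)
  zero_on_compl' x hx := hL h x hx

@[simp]
theorem slice_apply {W : ℝ × X → ℂ} (hW : ContDiff ℝ ∞ W) (hL : ∀ h, ∀ x ∉ L, W (h, x) = 0)
    (h : ℝ) (x : X) : slice hW hL h x = W (h, x) := rfl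

/-- Each derivative in `x` is jointly continuous in `(h, x)`, so its continuity in `h` is uniform
over the compact `L`; off `L` it vanishes. -/
theorem continuous_slice {W : ℝ × X → ℂ} (hW : ContDiff ℝ ∞ W)
    (hL : ∀ h, ∀ x ∉ L, W (h, x) = 0) : Continuous (slice hW hL) := by
  rw [ContDiffMapSupportedIn.continuous_iff_comp]
  intro i
  let J : ℝ → X → X [×i]→L[ℝ] ℂ := fun h x =>
    (iteratedFDeriv ℝ i W (h, x)).compContinuousLinearMap fun _ => ContinuousLinearMap.inr ℝ ℝ X
  have hJ : ∀ h x, iteratedFDeriv ℝ i (slice hW hL h) x = J h x := by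
    intro h x
    have h1 : (slice hW hL h : X → ℂ) =
        (fun z : ℝ × X => W (z + (h, 0))) ∘ ContinuousLinearMap.inr ℝ ℝ X := by
      funext y
      simp
    rw [h1, ContinuousLinearMap.iteratedFDeriv_comp_right (n := ∞) _
      (f := fun z : ℝ × X => W (z + (h, 0)))
      (hW.comp (contDiff_id.add contDiff_const)) x (mod_cast le_top),
      iteratedFDeriv_comp_add_right]
    simp [J]
  have hJc : Continuous (Function.uncurry J) := by
    have h1 : Continuous (iteratedFDeriv ℝ i W) :=
      hW.continuous_iteratedFDeriv (m := i) (mod_cast le_top)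
    exact (ContinuousMultilinearMap.compContinuousLinearMapL (𝕜 := ℝ) (F := ℂ)
      (fun _ : Fin i => ContinuousLinearMap.inr ℝ ℝ X)).continuous.comp h1
  rw [continuous_iff_continuousAt]
  intro h₀
  refine BoundedContinuousFunction.tendsto_iff_tendstoUniformly.2 ?_
  rw [Metric.tendstoUniformly_iff]
  intro ε hε
  have h1 : ∀ᶠ h in 𝓝 h₀, ∀ x ∈ (L : Set X), dist (J h₀ x) (J h x) < ε := by
    refine L.isCompact.eventually_forall_of_forall_eventually fun x _ => ?_
    have hc : Continuous fun z : ℝ × X => dist (J h₀ z.2) (J z.1 z.2) :=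
      (hJc.comp (continuous_const.prodMk continuous_snd)).dist hJc
    exact hc.continuousAt.eventually_lt continuousAt_const (by simpa using hε)
  filter_upwards [h1] with h hh x
  have he : ∀ h', (ContDiffMapSupportedIn.structureMapCLM ℝ ⊤ i ∘ slice hW hL) h' x = J h' x := by
    intro h'
    rw [← hJ]
    exact congrFun (ContDiffMapSupportedIn.structureMapCLM_top_apply ℝ (slice hW hL h')) x
  rw [he, he]
  by_cases hx : x ∈ L
  · exact hh x hx
  · have hz : ∀ h', J h' x = 0 := fun h' => by
      rw [← hJ]
      exact ContDiffMapSupportedIn.iteratedFDeriv_zero_on_compl (slice hW hL h') hx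
    simpa [hz] using hε

/-- By linearity the difference quotient of `T` along the family is `T` of the Hadamard quotient
`G`. This is again a smooth family supported in `L`, hence continuous at `h = 0`. -/
theorem hasDerivAt_apply_slice (T : 𝓓_{L}(X, ℂ) →L[ℂ] ℂ) {W W' : ℝ × X → ℂ}
    (hW : ContDiff ℝ ∞ W) (hL : ∀ h, ∀ x ∉ L, W (h, x) = 0)
    (hW' : ContDiff ℝ ∞ W') (hL' : ∀ h, ∀ x ∉ L, W' (h, x) = 0)
    (hd : ∀ h x, HasDerivAt (fun h => W (h, x)) (W' (h, x)) h) (t : ℝ) :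
    HasDerivAt (fun h => T (slice hW hL h)) (T (slice hW' hL' t)) t := by
  obtain ⟨G, hG, hquot, hder⟩ := exists_contDiff_difference_quotient
    (W := fun z : ℝ × X => W (t + z.1, z.2))
    (hW.comp ((contDiff_const.add contDiff_fst).prodMk contDiff_snd))
  have hGz : ∀ x ∉ L, ∀ h ≠ 0, G (h, x) = 0 := by
    intro x hx h hh
    have := hquot h x
    simp only [hL _ x hx, sub_zero] at this
    exact (smul_eq_zero.1 this.symm).resolve_left hh
  have hG0 : ∀ x, G (0, x) = W' (t, x) := by
    intro x
    have h1 : HasDerivAt (fun h => W (t + h, x)) (W' (t, x)) 0 := by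
      have h0 := hd t x
      rw [← add_zero t] at h0
      simpa using! h0.comp_const_add t 0
    exact (hder x).unique h1
  have hGL : ∀ h, ∀ x ∉ L, G (h, x) = 0 := by
    intro h x hx
    by_cases hh : h = 0
    · rw [hh, hG0, hL' _ x hx]
    · exact hGz x hx h hh
  rw [hasDerivAt_iff_tendsto_slope_zero]
  have h1 : Tendsto (fun h => T (slice hG hGL h)) (𝓝[≠] 0) (𝓝 (T (slice hG hGL 0))) :=
    ((T.continuous.comp (continuous_slice hG hGL)).tendsto 0).mono_left nhdsWithin_le_nhds
  have h2 : slice hG hGL 0 = slice hW' hL' t := by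
    ext x
    exact hG0 x
  rw [h2] at h1
  refine h1.congr' ?_
  filter_upwards [self_mem_nhdsWithin] with h hh
  have h3 : slice hW hL (t + h) - slice hW hL t = (h : ℂ) • slice hG hGL h := by
    ext x
    have := hquot h x
    simpa using this
  rw [← map_sub, h3, map_smul]
  have : (h : ℂ) ≠ 0 := Complex.ofReal_ne_zero.2 hh
  simp [Complex.real_smul, this]

end Families

/-! ### Test functions on phase space -/

/-- The function on phase space whose Fourier transform in the position variable is `Φ`. -/
def toPhase {d : ℕ} (Φ : Sp d × Sp d → ℂ) (r k : Sp d) : ℂ :=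
  (((2 * Real.pi : ℝ) : ℂ) ^ d)⁻¹ * ∫ v, Complex.exp (Complex.I * (inner ℝ r v : ℝ)) * Φ (v, k)

section Phase

variable {d : ℕ}

/-- Fourier inversion for Schwartz functions. The substitution `r = 2πw` passes to the transform
with `2π` in the exponent, and its Jacobian `(2π)^d` cancels the prefactor of `toPhase`. -/
theorem positionFourier_toPhase {Φ : Sp d × Sp d → ℂ} (hΦ : ContDiff ℝ ∞ Φ)
    (hc : HasCompactSupport Φ) (v k : Sp d) : positionFourier (toPhase Φ) v k = Φ (v, k) := by
  have hk : ContDiff ℝ ∞ fun v => Φ (v, k) := hΦ.comp (contDiff_id.prodMk contDiff_const)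
  have hkc : HasCompactSupport fun v => Φ (v, k) := by
    refine HasCompactSupport.intro (hc.image continuous_fst) fun v hv => ?_
    exact image_eq_zero_of_notMem_tsupport fun h => hv ⟨_, h, rfl⟩
  let f := hkc.toSchwartzMap hk
  have hinv : FourierTransform.fourier (FourierTransformInv.fourierInv fun v => Φ (v, k)) v =
      Φ (v, k) := by
    have h1 : FourierTransform.fourier (FourierTransformInv.fourierInv (f : Sp d → ℂ)) = f := by
      refine f.continuous.fourier_fourierInv_eq f.integrable ?_
      rw [← SchwartzMap.fourier_coe]
      exact (FourierTransform.fourier f).integrable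
    exact congrFun h1 v
  rw [← hinv]
  set g := FourierTransformInv.fourierInv fun v => Φ (v, k) with hg
  have hp : (0 : ℝ) < 2 * Real.pi := by positivity
  have h1 : ∀ r, toPhase Φ r k = (((2 * Real.pi : ℝ) : ℂ) ^ d)⁻¹ * g ((2 * Real.pi)⁻¹ • r) := by
    intro r
    rw [toPhase, hg, Real.fourierInv_eq']
    congr 2
    funext w
    rw [smul_eq_mul, real_inner_smul_right, real_inner_comm, mul_inv_cancel_left₀ hp.ne', mul_comm
      Complex.I]
  let G : Sp d → ℂ := fun w => (((2 * Real.pi : ℝ) : ℂ) ^ d)⁻¹ *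
    (Complex.exp (((-2 * Real.pi * inner ℝ w v : ℝ) : ℂ) * Complex.I) • g w)
  have h2 : ∀ r : Sp d, Complex.exp (-Complex.I * (inner ℝ r v : ℝ)) * toPhase Φ r k =
      G ((2 * Real.pi)⁻¹ • r) := by
    intro r
    rw [h1]
    simp only [G, real_inner_smul_left, smul_eq_mul]
    rw [show -2 * Real.pi * ((2 * Real.pi)⁻¹ * inner ℝ r v) = -inner ℝ r v by field_simp]
    push_cast
    ring_nf
  rw [positionFourier, integral_congr_ae (Eventually.of_forall h2), Measure.integral_comp_smul volume G,
    Real.fourier_eq', integral_const_mul, finrank_euclideanSpace_fin, inv_pow, inv_inv,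
    abs_of_pos (by positivity), Complex.real_smul, ← mul_assoc]
  have : ((2 * Real.pi : ℝ) : ℂ) ^ d ≠ 0 := pow_ne_zero _ (Complex.ofReal_ne_zero.2 hp.ne')
  rw [Complex.ofReal_pow, mul_inv_cancel₀ this, one_mul]

theorem isPhaseTest_iff {Ω : TopologicalSpace.Opens (Sp d)} {φ : Sp d → Sp d → ℂ} :
    IsPhaseTest Ω φ ↔
      ∃ Φ : 𝓓(box (⊤ : TopologicalSpace.Opens (Sp d)) Ω, ℂ), φ = toPhase Φ :=
  ⟨fun ⟨Φ, h⟩ => ⟨Φ, funext fun r => funext fun k => h r k⟩, fun ⟨Φ, h⟩ => ⟨Φ, fun r k => by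
    rw [h]; rfl⟩⟩

theorem toPhase_add (Φ : Sp d × Sp d → ℂ) (r w k : Sp d) :
    toPhase Φ (r + w) k =
      toPhase (fun z => Complex.exp (Complex.I * (inner ℝ w z.1 : ℝ)) * Φ z) r k := by
  simp only [toPhase]
  congr 2
  funext v
  rw [inner_add_left, ← mul_assoc, ← Complex.exp_add]
  push_cast
  ring_nf

theorem toPhase_congr {Φ Ψ : Sp d × Sp d → ℂ} {k : Sp d} (h : ∀ v, Φ (v, k) = Ψ (v, k))
    (r : Sp d) : toPhase Φ r k = toPhase Ψ r k := by
  simp only [toPhase, h]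

theorem fderiv_toPhase {Φ : Sp d × Sp d → ℂ} (hΦ : Continuous Φ)
    (hc : HasCompactSupport Φ) (r k w : Sp d) :
    fderiv ℝ (fun r' => toPhase Φ r' k) r w =
      toPhase (fun z => Complex.I * (inner ℝ w z.1 : ℝ) * Φ z) r k := by
  have hk : Continuous fun v => Φ (v, k) := by fun_prop
  have hkc : HasCompactSupport fun v => Φ (v, k) := by
    refine HasCompactSupport.intro (hc.image continuous_fst) fun v hv => ?_
    exact image_eq_zero_of_notMem_tsupport fun h => hv ⟨_, h, rfl⟩
  let F' : Sp d → Sp d → Sp d →L[ℝ] ℂ := fun r v =>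
    (Complex.exp (Complex.I * (inner ℝ r v : ℝ)) * Φ (v, k) * Complex.I) •
      (Complex.ofRealCLM ∘L innerSL ℝ v)
  have hcontF' : Continuous (F' r) := by fun_prop
  have hF'norm : ∀ r v, ‖F' r v‖ ≤ ‖v‖ * ‖Φ (v, k)‖ := by
    intro r v
    refine ContinuousLinearMap.opNorm_le_bound _ (by positivity) fun w => ?_
    have h1 : ‖Complex.exp (Complex.I * (inner ℝ r v : ℝ))‖ = 1 := by
      rw [mul_comm]
      exact Complex.norm_exp_ofReal_mul_I _
    have h2 : |inner ℝ v w| ≤ ‖v‖ * ‖w‖ := abs_real_inner_le_norm v w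
    simp only [F', _root_.smul_apply, ContinuousLinearMap.comp_apply, norm_smul,
      norm_mul, h1, Complex.norm_I, Complex.ofRealCLM_apply, Complex.norm_real, Real.norm_eq_abs,
      innerSL_apply_apply]
    nlinarith [norm_nonneg (Φ (v, k))]
  have hD : HasFDerivAt (fun r => ∫ v, Complex.exp (Complex.I * (inner ℝ r v : ℝ)) * Φ (v, k))
      (∫ v, F' r v) r := by
    refine hasFDerivAt_integral_of_dominated_of_fderiv_le (s := Set.univ) univ_mem
      (bound := fun v => ‖v‖ * ‖Φ (v, k)‖)
      (Eventually.of_forall fun r => ?_) ?_ ?_ (Eventually.of_forall fun v r _ => hF'norm r v) ?_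
      (Eventually.of_forall fun v r _ => ?_)
    · exact Continuous.aestronglyMeasurable (by fun_prop)
    · exact Continuous.integrable_of_hasCompactSupport (by fun_prop) hkc.mul_left
    · exact hcontF'.aestronglyMeasurable
    · exact Continuous.integrable_of_hasCompactSupport (by fun_prop) hkc.norm.mul_left
    · have h1 : HasFDerivAt (fun r : Sp d => inner ℝ r v) (innerSL ℝ v) r := by
        have := (innerSL ℝ v).hasFDerivAt (x := r)
        refine this.congr_of_eventuallyEq (Eventually.of_forall fun y => ?_)
        simp [real_inner_comm]
      have h2 : HasFDerivAt (fun r : Sp d => Complex.I * ((inner ℝ r v : ℝ) : ℂ))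
          (Complex.I • (Complex.ofRealCLM ∘L innerSL ℝ v)) r :=
        (Complex.ofRealCLM.hasFDerivAt.comp r h1).const_mul Complex.I
      have h3 := (h2.cexp).mul_const (Φ (v, k))
      refine h3.congr_fderiv ?_
      ext w
      simp only [F', _root_.smul_apply, ContinuousLinearMap.comp_apply, smul_eq_mul]
      ring
  have hint : Integrable (F' r) := by
    refine Integrable.mono' (g := fun v => ‖v‖ * ‖Φ (v, k)‖) ?_ hcontF'.aestronglyMeasurable
      (Eventually.of_forall (hF'norm r))
    exact Continuous.integrable_of_hasCompactSupport (by fun_prop) hkc.norm.mul_left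
  have h4 : HasFDerivAt (fun r' => toPhase Φ r' k)
      ((((2 * Real.pi : ℝ) : ℂ) ^ d)⁻¹ • ∫ v, F' r v) r := hD.const_mul _
  rw [h4.fderiv, _root_.smul_apply, ContinuousLinearMap.integral_apply hint, toPhase,
    smul_eq_mul]
  congr 2
  funext v
  simp only [F', _root_.smul_apply, ContinuousLinearMap.comp_apply, smul_eq_mul,
    Complex.ofRealCLM_apply, innerSL_apply_apply, real_inner_comm]
  ring

/-- The Fourier symbol `v · ∇E` of the transport operator. -/
def transportSymbol (E : Sp d → ℝ) (z : Sp d × Sp d) : ℂ :=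
  Complex.I * (inner ℝ (∇ E z.2) z.1 : ℝ)

theorem contDiffOn_gradient {E : Sp d → ℝ} {Ω : TopologicalSpace.Opens (Sp d)}
    (hE : ContDiffOn ℝ ∞ E Ω) : ContDiffOn ℝ ∞ (∇ E) Ω :=
  (InnerProductSpace.toDual ℝ (Sp d)).symm.contDiff.comp_contDiffOn
    (hE.fderiv_of_isOpen Ω.isOpen (by simp))

theorem contDiffOn_transportSymbol {E : Sp d → ℝ} {Ω : TopologicalSpace.Opens (Sp d)}
    (hE : ContDiffOn ℝ ∞ E Ω) :
    ContDiffOn ℝ ∞ (transportSymbol E) (box (⊤ : TopologicalSpace.Opens (Sp d)) Ω) := by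
  have h1 : ContDiffOn ℝ ∞ (fun z : Sp d × Sp d => ∇ E z.2)
      (box (⊤ : TopologicalSpace.Opens (Sp d)) Ω) :=
    (contDiffOn_gradient hE).comp contDiff_snd.contDiffOn fun z hz => hz.2
  exact contDiffOn_const.mul (Complex.ofRealCLM.contDiff.comp_contDiffOn
    (h1.inner ℝ contDiff_fst.contDiffOn))

theorem contDiffOn_exp_transportSymbol {E : Sp d → ℝ} {Ω : TopologicalSpace.Opens (Sp d)}
    (hE : ContDiffOn ℝ ∞ E Ω) (t : ℝ) :
    ContDiffOn ℝ ∞ (fun z => Complex.exp (t * transportSymbol E z))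
      (box (⊤ : TopologicalSpace.Opens (Sp d)) Ω) :=
  (contDiffOn_const.mul (contDiffOn_transportSymbol hE)).cexp

/-- The Fourier transform is taken in `r` alone, so a translation may depend on `k`: for each `k` it
is a modulation in `v`. -/
theorem toPhase_transport (E : Sp d → ℝ) (Φ : Sp d × Sp d → ℂ) (t : ℝ) (r k : Sp d) :
    toPhase Φ (r + t • ∇ E k) k =
      toPhase (fun z => Complex.exp (t * transportSymbol E z) * Φ z) r k := by
  rw [toPhase_add]
  refine toPhase_congr (fun v => ?_) r
  simp only [transportSymbol, real_inner_smul_left]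
  push_cast
  ring_nf

theorem fderiv_toPhase_gradient (E : Sp d → ℝ) {Φ : Sp d × Sp d → ℂ} (hΦ : Continuous Φ)
    (hc : HasCompactSupport Φ) (r k : Sp d) :
    fderiv ℝ (fun r' => toPhase Φ r' k) r (∇ E k) =
      toPhase (fun z => transportSymbol E z * Φ z) r k := by
  rw [fderiv_toPhase hΦ hc]
  exact toPhase_congr (fun v => rfl) r

end Phase

/-! ### Bessel's inequality for the characters of a lattice -/

section Bessel

/-- The interval has length `2πM`, a whole number of periods, so the primitive takes the same value
at both ends. -/
theorem integral_exp_int_mul_eq_zero {m : ℤ} (hm : m ≠ 0) (M : ℕ) :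
    ∫ θ in Set.Ioc (-(M * Real.pi)) (M * Real.pi),
      Complex.exp (Complex.I * ((m * θ : ℝ) : ℂ)) = 0 := by
  have hle : -(M * Real.pi) ≤ M * Real.pi := by
    have : 0 ≤ M * Real.pi := by positivity
    linarith
  have hc : Complex.I * m ≠ 0 := mul_ne_zero Complex.I_ne_zero (Int.cast_ne_zero.2 hm)
  rw [← intervalIntegral.integral_of_le hle]
  have h1 := integral_exp_mul_complex (a := -(M * Real.pi)) (b := M * Real.pi) hc
  have h2 : ∀ θ : ℝ, Complex.exp (Complex.I * ((m * θ : ℝ) : ℂ)) =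
      Complex.exp (Complex.I * m * θ) := by
    intro θ
    push_cast
    ring_nf
  simp only [h2]
  rw [h1]
  have h3 : Complex.exp (Complex.I * m * ((M * Real.pi : ℝ) : ℂ)) =
      Complex.exp (Complex.I * m * ((-(M * Real.pi) : ℝ) : ℂ)) := by
    rw [Complex.exp_eq_exp_iff_exists_int]
    refine ⟨m * M, ?_⟩
    push_cast
    ring
  rw [h3, sub_self, zero_div]

variable {d : ℕ} (b : Module.Basis (Fin d) ℝ (Sp d))

/-- The coordinates `k ↦ (k · b i)ᵢ`, as a linear map. -/
def dualCoordLM : Sp d →ₗ[ℝ] (Fin d → ℝ) := LinearMap.pi fun i => innerₗ (Sp d) (b i)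

theorem dualCoordLM_injective : Function.Injective (dualCoordLM b) := by
  rw [← LinearMap.ker_eq_bot, LinearMap.ker_eq_bot']
  intro k hk
  refine InnerProductSpace.ext_inner_left_basis (𝕜 := ℝ) b fun i => ?_
  simpa [dualCoordLM] using congrFun hk i

/-- The coordinates `k ↦ (k · b i)ᵢ`. -/
def dualCoord : Sp d ≃L[ℝ] (Fin d → ℝ) :=
  (LinearEquiv.ofBijective (dualCoordLM b) ⟨dualCoordLM_injective b,
    (LinearMap.injective_iff_surjective_of_finrank_eq_finrank (by simp)).1
      (dualCoordLM_injective b)⟩).toContinuousLinearEquiv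

@[simp]
theorem dualCoord_apply (k : Sp d) (i : Fin d) : dualCoord b k i = inner ℝ k (b i) := by
  rw [real_inner_comm]
  rfl

/-- A large box in the dual space, a union of cells of the dual lattice. -/
def dualBox (M : ℕ) : Set (Sp d) :=
  dualCoord b ⁻¹' (Set.univ.pi fun _ => Set.Ioc (-(M * Real.pi)) (M * Real.pi))

theorem measurableSet_dualBox (M : ℕ) : MeasurableSet (dualBox b M) :=
  (dualCoord b).continuous.measurable (MeasurableSet.univ_pi fun _ => measurableSet_Ioc)

theorem volume_dualBox_ne_top (M : ℕ) : volume (dualBox b M) ≠ ⊤ := by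
  refine ne_of_lt (lt_of_le_of_lt (measure_mono ?_)
    ((dualCoord b).toHomeomorph.isCompact_preimage.2 (isCompact_univ_pi fun _ =>
      isCompact_Icc (a := -(M * Real.pi)) (b := M * Real.pi))).measure_lt_top)
  exact Set.preimage_mono (Set.pi_mono fun _ _ => Set.Ioc_subset_Icc_self)

theorem exists_subset_dualBox {S : Set (Sp d)} (hS : Bornology.IsBounded S) :
    ∃ M : ℕ, S ⊆ dualBox b M := by
  have h1 : Bornology.IsBounded (dualCoord b '' S) :=
    (dualCoord b).lipschitz.isBounded_image hS
  obtain ⟨R, hR⟩ := h1.exists_norm_le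
  obtain ⟨M, hM⟩ := exists_nat_gt (R / Real.pi)
  refine ⟨M, fun k hk i _ => ?_⟩
  have h2 := (norm_le_pi_norm (dualCoord b k) i).trans (hR _ ⟨k, hk, rfl⟩)
  rw [div_lt_iff₀ Real.pi_pos] at hM
  rw [Real.norm_eq_abs, abs_le] at h2
  exact ⟨by linarith, by linarith⟩

/-- In the coordinates `θᵢ = k · b i` the character is a product of `exp(i mᵢ θᵢ)` with integers
`mᵢ`, one of them nonzero. -/
theorem setIntegral_dualBox_character {γ : Sp d}
    (hγ : γ ∈ Submodule.span ℤ (Set.range b)) (hγ0 : γ ≠ 0) (M : ℕ) :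
    ∫ k in dualBox b M, Complex.exp (Complex.I * (inner ℝ k γ : ℝ)) = 0 := by
  have hrep : ∀ i, ∃ m : ℤ, (m : ℝ) = b.repr γ i := by
    intro i
    obtain ⟨m, hm⟩ := (b.mem_span_iff_repr_mem ℤ γ).1 hγ i
    exact ⟨m, by simpa using hm⟩
  choose m hm using hrep
  obtain ⟨i₀, hi₀⟩ : ∃ i, m i ≠ 0 := by
    by_contra! hcon
    refine hγ0 (b.repr.map_eq_zero_iff.1 (Finsupp.ext fun i => ?_))
    rw [← hm i, hcon i]
    simp
  let f : Fin d → ℝ → ℂ := fun i θ => Complex.exp (Complex.I * ((m i * θ : ℝ) : ℂ))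
  have h1 : ∀ k : Sp d, Complex.exp (Complex.I * (inner ℝ k γ : ℝ)) =
      (fun θ : Fin d → ℝ => ∏ i, f i (θ i)) (dualCoord b k) := by
    intro k
    simp only [f, ← Complex.exp_sum, ← Finset.mul_sum, dualCoord_apply]
    congr 2
    conv_lhs => rw [← b.sum_repr γ]
    rw [inner_sum]
    push_cast
    refine Finset.sum_congr rfl fun i _ => ?_
    rw [real_inner_smul_right, ← hm i]
    push_cast
    rfl
  rw [integral_congr_ae (Eventually.of_forall h1)]
  have hmeas : MeasurableEmbedding (dualCoord b) :=
    (dualCoord b).toHomeomorph.measurableEmbedding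
  rw [dualBox, ← hmeas.setIntegral_map (fun θ : Fin d → ℝ => ∏ i, f i (θ i))]
  have hpi : ∫ θ in Set.univ.pi fun _ => Set.Ioc (-(M * Real.pi)) (M * Real.pi),
      ∏ i, f i (θ i) = 0 := by
    rw [volume_pi, Measure.restrict_pi_pi, integral_fintype_prod_eq_prod,
      Finset.prod_eq_zero (Finset.mem_univ i₀) (integral_exp_int_mul_eq_zero hi₀ M)]
  -- By uniqueness of Haar measure the image measure is a multiple of Lebesgue measure; as the
  -- integral vanishes, the factor is irrelevant.
  rw [Measure.isAddLeftInvariant_eq_smul (Measure.map (dualCoord b) (volume : Measure (Sp d)))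
    (volume : Measure (Fin d → ℝ)), Measure.restrict_smul, integral_smul_nnreal_measure, hpi,
    smul_zero]

end Bessel

theorem enorm_toLp_sq {Y : Type*} [MeasurableSpace Y] {μ : Measure Y} {f : Y → ℂ}
    (hf : MemLp f 2 μ) : ‖hf.toLp f‖ₑ ^ 2 = ∫⁻ y, ‖f y‖ₑ ^ 2 ∂μ := by
  rw [Lp.enorm_toLp, eLpNorm_eq_lintegral_rpow_enorm_toReal (by norm_num) (by norm_num)]
  simp only [ENNReal.toReal_ofNat, ENNReal.rpow_ofNat, one_div]
  rw [← ENNReal.rpow_natCast, ← ENNReal.rpow_mul]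
  norm_num

theorem memLp_two_iff_lintegral {Y : Type*} [MeasurableSpace Y] {μ : Measure Y} {f : Y → ℂ}
    (hf : AEStronglyMeasurable f μ) : MemLp f 2 μ ↔ ∫⁻ y, ‖f y‖ₑ ^ 2 ∂μ < ⊤ := by
  have h1 := eLpNorm_lt_top_iff_lintegral_rpow_enorm_lt_top (f := f) (μ := μ) (p := 2)
    (by norm_num) (by norm_num)
  simp only [ENNReal.toReal_ofNat, ENNReal.rpow_ofNat] at h1
  rw [← h1]
  exact ⟨fun h => h.2, fun h => ⟨hf, h⟩⟩

/-- Bessel's inequality for orthogonal unimodular functions. -/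
theorem tsum_enorm_integral_sq_le {Y ι : Type*} [MeasurableSpace Y] {μ : Measure Y}
    [IsFiniteMeasure μ] {e : ι → Y → ℂ} (hem : ∀ i, Measurable (e i))
    (he1 : ∀ i y, ‖e i y‖ = 1) (horth : ∀ i j, i ≠ j → ∫ y, conj (e i y) * e j y ∂μ = 0)
    {h : Y → ℂ} (hh : MemLp h 2 μ) :
    ∑' i, ‖∫ y, conj (e i y) * h y ∂μ‖ₑ ^ 2 ≤ μ Set.univ * ∫⁻ y, ‖h y‖ₑ ^ 2 ∂μ := by
  have hinner : ∀ {f g : Y → ℂ} (hf : MemLp f 2 μ) (hg : MemLp g 2 μ),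
      inner ℂ (hf.toLp f) (hg.toLp g) = ∫ y, conj (f y) * g y ∂μ := by
    intro f g hf hg
    rw [L2.inner_def]
    refine integral_congr_ae ?_
    filter_upwards [hf.coeFn_toLp, hg.coeFn_toLp] with y h1 h2
    rw [h1, h2, RCLike.inner_apply, mul_comm]
  have heL : ∀ i, MemLp (e i) 2 μ := fun i =>
    MemLp.of_bound (hem i).aestronglyMeasurable 1 (Eventually.of_forall fun y => (he1 i y).le)
  by_cases hμ : μ = 0
  · simp [hμ]
  have hV : 0 < μ.real Set.univ := by
    rw [measureReal_def, ENNReal.toReal_pos_iff]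
    exact ⟨by simpa [pos_iff_ne_zero] using hμ, measure_lt_top _ _⟩
  set V := μ.real Set.univ with hVdef
  -- A unimodular function has squared norm `V`, the total mass, which is positive here; this is
  -- where the factor `μ Set.univ` in the bound comes from.
  let v : ι → Lp ℂ 2 μ := fun i => ((Real.sqrt V)⁻¹ : ℂ) • (heL i).toLp (e i)
  have hon : Orthonormal ℂ v := by
    classical
    rw [orthonormal_iff_ite]
    intro i j
    simp only [v, inner_smul_left, inner_smul_right, hinner]
    split_ifs with hij
    · subst hij
      have : ∀ y, conj (e i y) * e i y = 1 := fun y => by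
        rw [mul_comm, Complex.mul_conj, Complex.normSq_eq_norm_sq, he1]
        simp
      simp only [this, integral_const, ← hVdef]
      have h2 : (Real.sqrt V : ℂ) * Real.sqrt V = V := by
        rw [← Complex.ofReal_mul, Real.mul_self_sqrt hV.le]
      have h3 : (Real.sqrt V : ℂ) ≠ 0 := Complex.ofReal_ne_zero.2 (Real.sqrt_pos.2 hV).ne'
      have h4 : conj ((Real.sqrt V : ℂ)⁻¹) = (Real.sqrt V : ℂ)⁻¹ := by
        rw [map_inv₀, Complex.conj_ofReal]
      rw [h4, Complex.real_smul, ← h2]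
      field_simp
    · rw [horth i j hij]
      simp
  have hnorm := enorm_toLp_sq hh
  have hcoef : ∀ i, ‖∫ y, conj (e i y) * h y ∂μ‖ ^ 2 =
      V * ‖inner ℂ (v i) (hh.toLp h)‖ ^ 2 := by
    intro i
    simp only [v, inner_smul_left, hinner, norm_mul, mul_pow, map_inv₀, norm_inv,
      Complex.conj_ofReal, Complex.norm_real, inv_pow, Real.norm_eq_abs, sq_abs,
      Real.sq_sqrt hV.le]
    field_simp
  have hof : ∀ z : ℂ, ‖z‖ₑ ^ 2 = ENNReal.ofReal (‖z‖ ^ 2) := fun z => by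
    rw [ENNReal.ofReal_pow (norm_nonneg _), ofReal_norm]
  rw [ENNReal.tsum_eq_iSup_sum]
  refine iSup_le fun s => ?_
  rw [← hnorm]
  simp only [hof]
  rw [← ENNReal.ofReal_sum_of_nonneg (fun _ _ => by positivity)]
  have h5 : μ Set.univ * ‖hh.toLp h‖ₑ ^ 2 = ENNReal.ofReal (V * ‖hh.toLp h‖ ^ 2) := by
    rw [ENNReal.ofReal_mul hV.le, ENNReal.ofReal_pow (norm_nonneg _), ofReal_norm, hVdef,
      measureReal_def, ENNReal.ofReal_toReal (measure_ne_top _ _)]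
  rw [h5]
  refine ENNReal.ofReal_le_ofReal ?_
  simp only [hcoef, ← Finset.mul_sum]
  exact mul_le_mul_of_nonneg_left (hon.sum_inner_products_le _) hV.le

/-! ### Wave packets built from the Bloch functions of one band -/

/-- The properties of the Bloch functions of one band that bound its wave packets. -/
structure IsBand {d : ℕ} (b : Module.Basis (Fin d) ℝ (Sp d)) (C : ENNReal)
    (ψ : Sp d → Sp d → ℂ) : Prop where
  measurable : Measurable (Function.uncurry ψ)
  quasiperiodic : ∀ k i x,
    ψ k (x + b i) = Complex.exp (-Complex.I * (inner ℝ k (b i) : ℝ)) * ψ k x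
  lintegral_cell_le : ∀ k, ∫⁻ x in ZSpan.fundamentalDomain b, ‖ψ k x‖ₑ ^ 2 ≤ C

theorem IsBlochSystem.isBand {d : ℕ} {b : Module.Basis (Fin d) ℝ (Sp d)} {U : Sp d → ℝ} {N : ℝ}
    {ψ : ℕ → Sp d → Sp d → ℂ} {E : ℕ → Sp d → ℝ} (hψ : IsBlochSystem b U N ψ E) (n : ℕ) :
    IsBand b (ENNReal.ofReal N) (ψ n) where
  measurable := hψ.measurable n
  quasiperiodic := hψ.quasiperiodic n
  lintegral_cell_le k := by
    have h1 := hψ.orthogonal k n n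
    have h2 : ∀ x, conj (ψ n k x) * ψ n k x = ((‖ψ n k x‖ ^ 2 : ℝ) : ℂ) := fun x => by
      rw [mul_comm, Complex.mul_conj, Complex.normSq_eq_norm_sq]
    simp only [h2, if_true, integral_complex_ofReal] at h1
    have h3 : ∫ x in ZSpan.fundamentalDomain b, ‖ψ n k x‖ ^ 2 = N := by exact_mod_cast h1
    -- A non-integrable function has Bochner integral 0, whereas this integral equals `N > 0`.
    have hint : IntegrableOn (fun x => ‖ψ n k x‖ ^ 2) (ZSpan.fundamentalDomain b) := by
      by_contra hcon
      rw [integral_undef hcon] at h3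
      exact hψ.norm_pos.ne h3
    rw [← h3, ofReal_integral_eq_lintegral_ofReal hint
      (Eventually.of_forall fun x => by positivity)]
    refine le_of_eq (lintegral_congr fun x => ?_)
    rw [ENNReal.ofReal_pow (norm_nonneg _), ofReal_norm]

namespace IsBand

variable {d : ℕ} {b : Module.Basis (Fin d) ℝ (Sp d)} {C : ENNReal} {ψ : Sp d → Sp d → ℂ}

theorem add_lattice (hψ : IsBand b C ψ) {γ : Sp d}
    (hγ : γ ∈ Submodule.span ℤ (Set.range b)) : ∀ k x,
    ψ k (x + γ) = Complex.exp (-Complex.I * (inner ℝ k γ : ℝ)) * ψ k x := by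
  rw [← Submodule.mem_toAddSubgroup, Submodule.span_int_eq_addSubgroupClosure] at hγ
  induction hγ using AddSubgroup.closure_induction with
  | mem γ h =>
    obtain ⟨i, rfl⟩ := h
    exact fun k x => hψ.quasiperiodic k i x
  | zero => simp
  | add γ γ' _ _ h h' =>
    intro k x
    rw [← add_assoc, h', h, inner_add_right, ← mul_assoc, ← Complex.exp_add]
    push_cast
    ring_nf
  | neg γ _ h =>
    intro k x
    have h1 := h k (x + -γ)
    rw [neg_add_cancel_right] at h1
    rw [h1, ← mul_assoc, ← Complex.exp_add, inner_neg_right]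
    push_cast
    ring_nf
    simp

theorem enorm_add_lattice (hψ : IsBand b C ψ) {γ : Sp d}
    (hγ : γ ∈ Submodule.span ℤ (Set.range b)) (k x : Sp d) : ‖ψ k (x + γ)‖ₑ = ‖ψ k x‖ₑ := by
  rw [hψ.add_lattice hγ, enorm_mul]
  have : ‖Complex.exp (-Complex.I * (inner ℝ k γ : ℝ))‖ₑ = 1 := by
    rw [← ofReal_norm, show -Complex.I * ((inner ℝ k γ : ℝ) : ℂ) =
      ((-inner ℝ k γ : ℝ) : ℂ) * Complex.I by push_cast; ring, Complex.norm_exp_ofReal_mul_I]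
    simp
  rw [this, one_mul]

theorem measurable_apply (hψ : IsBand b C ψ) (k : Sp d) : Measurable (ψ k) :=
  hψ.measurable.comp measurable_prodMk_left

/-- A bounded set meets finitely many lattice translates of the cell, and each contributes at most
`C` because `|ψ k|` is lattice periodic. -/
theorem exists_lintegral_le (hψ : IsBand b C ψ) (hC : C ≠ ⊤) {T : Set (Sp d)}
    (hT : MeasurableSet T) (hTb : Bornology.IsBounded T) :
    ∃ C' : ENNReal, C' ≠ ⊤ ∧ ∀ k, ∫⁻ x in T, ‖ψ k x‖ₑ ^ 2 ≤ C' := by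
  let Γ := (Submodule.span ℤ (Set.range b)).toAddSubgroup
  have : Countable (Submodule.span ℤ (Set.range b)).toAddSubgroup :=
    TopologicalSpace.separableSpace_iff_countable.1 inferInstance
  obtain ⟨R, hR⟩ := hTb.exists_norm_le
  obtain ⟨R', hR'⟩ := (ZSpan.fundamentalDomain_isBounded b).exists_norm_le
  have hfin : Set.Finite {γ : Γ | ‖(γ : Sp d)‖ ≤ R + R'} := by
    have h1 := ZSpan.setFinite_inter b (Metric.isBounded_closedBall (x := (0 : Sp d))
      (r := R + R'))
    refine Set.Finite.of_finite_image (f := fun γ : Γ => (γ : Sp d)) (h1.subset ?_)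
      Subtype.val_injective.injOn
    rintro _ ⟨γ, hγ, rfl⟩
    exact ⟨by simpa using hγ, γ.2⟩
  refine ⟨hfin.toFinset.card * C, ENNReal.mul_ne_top (ENNReal.natCast_ne_top _) hC, fun k => ?_⟩
  rw [← lintegral_indicator hT, (ZSpan.isAddFundamentalDomain' b volume).lintegral_eq_tsum']
  rw [tsum_eq_sum (s := hfin.toFinset)]
  · rw [← nsmul_eq_mul]
    refine Finset.sum_le_card_nsmul _ _ _ fun γ _ => ?_
    refine le_trans (lintegral_mono fun x => ?_) (hψ.lintegral_cell_le k)
    refine (Set.indicator_le_self _ _ _).trans (le_of_eq ?_)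
    rw [AddSubgroup.vadd_def, vadd_eq_add, add_comm]
    exact congrArg (· ^ 2) (hψ.enorm_add_lattice (-γ).2 k x)
  · intro γ hγ
    have h2 : ∀ x ∈ ZSpan.fundamentalDomain b,
        T.indicator (fun x => ‖ψ k x‖ₑ ^ 2) (-γ +ᵥ x) = 0 := by
      intro x hx
      refine Set.indicator_of_notMem (fun hmem => hγ ?_) _
      rw [Set.Finite.mem_toFinset, Set.mem_ofPred_eq]
      have h3 := hR _ hmem
      have h4 := hR' _ hx
      rw [AddSubgroup.vadd_def, vadd_eq_add] at h3
      have h5 : (γ : Sp d) = x - ((-γ : Γ) + x) := by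
        push_cast
        abel
      rw [h5]
      exact (norm_sub_le _ _).trans (by linarith)
    rw [setLIntegral_congr_fun (ZSpan.fundamentalDomain_measurableSet b) h2, lintegral_zero]

theorem measurable_mul (hψ : IsBand b C ψ) {g : Sp d → ℂ} (hg : Measurable g) :
    Measurable fun z : Sp d × Sp d => g z.1 * ψ z.1 z.2 :=
  (hg.comp measurable_fst).mul hψ.measurable

theorem aestronglyMeasurable_packet (hψ : IsBand b C ψ) {g : Sp d → ℂ} (hg : Measurable g) :
    StronglyMeasurable fun x => ∫ k, conj (g k * ψ k x) := by
  have h1 : StronglyMeasurable fun z : Sp d × Sp d => conj (g z.1 * ψ z.1 z.2) :=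
    (Complex.continuous_conj.measurable.comp (hψ.measurable_mul hg)).stronglyMeasurable
  exact h1.integral_prod_left'

/-- The bound on wave packets: by Bessel's inequality for the translates of `x` by the lattice. -/
theorem exists_lintegral_packet_le (hψ : IsBand b C ψ) (hC : C ≠ ⊤) {S : Set (Sp d)}
    (hS : Bornology.IsBounded S) :
    ∃ C' : ENNReal, C' ≠ ⊤ ∧ ∀ g : Sp d → ℂ, Measurable g → (∀ k ∉ S, g k = 0) →
      ∫⁻ x, ‖∫ k, conj (g k * ψ k x)‖ₑ ^ 2 ≤ C' * ∫⁻ k, ‖g k‖ₑ ^ 2 := by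
  let Γ := (Submodule.span ℤ (Set.range b)).toAddSubgroup
  have : Countable (Submodule.span ℤ (Set.range b)).toAddSubgroup :=
    TopologicalSpace.separableSpace_iff_countable.1 inferInstance
  obtain ⟨M, hM⟩ := exists_subset_dualBox b hS
  set Q := dualBox b M
  have hQ : MeasurableSet Q := measurableSet_dualBox b M
  have hQfin : IsFiniteMeasure (volume.restrict Q) :=
    ⟨by simpa using (volume_dualBox_ne_top b M).lt_top⟩
  -- The added 1 keeps the factor nonzero when `Q` is null, so that its product with an infinite
  -- integral is still `⊤`.
  refine ⟨(volume Q + 1) * C, ENNReal.mul_ne_top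
    (ENNReal.add_ne_top.2 ⟨volume_dualBox_ne_top b M, ENNReal.one_ne_top⟩) hC,
    fun g hg hgS => ?_⟩
  have hgQ : ∀ k ∉ Q, g k = 0 := fun k hk => hgS k fun h => hk (hM h)
  let e : Γ → Sp d → ℂ := fun γ k => Complex.exp (Complex.I * (inner ℝ k (γ : Sp d) : ℝ))
  have hem : ∀ γ, Measurable (e γ) := fun γ =>
    Continuous.measurable (by fun_prop)
  have he1 : ∀ γ k, ‖e γ k‖ = 1 := fun γ k => by
    simp only [e]
    rw [mul_comm, Complex.norm_exp_ofReal_mul_I]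
  have heconj : ∀ γ k, conj (e γ k) = Complex.exp (-Complex.I * (inner ℝ k (γ : Sp d) : ℝ)) := by
    intro γ k
    simp only [e]
    rw [← Complex.exp_conj, map_mul, Complex.conj_I, Complex.conj_ofReal]
  have horth : ∀ γ γ' : Γ, γ ≠ γ' → ∫ k in Q, conj (e γ k) * e γ' k = 0 := by
    intro γ γ' hne
    have h1 : ∀ k, conj (e γ k) * e γ' k =
        Complex.exp (Complex.I * (inner ℝ k ((γ' : Sp d) - γ) : ℝ)) := by
      intro k
      rw [heconj, ← Complex.exp_add, inner_sub_right]
      push_cast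
      ring_nf
    simp only [h1]
    exact setIntegral_dualBox_character b (sub_mem γ'.2 γ.2)
      (sub_ne_zero.2 fun h => hne (Subtype.ext h.symm)) M
  -- By quasi-periodicity the packet at the translates of `x` has, up to conjugation, the Fourier
  -- coefficients of `k ↦ g k * ψ k x` for the characters `e γ`, which are orthogonal on `Q`.
  have hpt : ∀ x, ∑' γ : Γ, ‖∫ k, conj (g k * ψ k (-γ +ᵥ x))‖ₑ ^ 2 ≤
      (volume Q + 1) * ∫⁻ k, ‖g k * ψ k x‖ₑ ^ 2 := by
    intro x
    by_cases hfin : ∫⁻ k, ‖g k * ψ k x‖ₑ ^ 2 = ⊤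
    · rw [hfin, ENNReal.mul_top (by simp)]
      exact le_top
    have hmeas : Measurable fun k => g k * ψ k x :=
      (hψ.measurable_mul hg).comp measurable_prodMk_right
    have hL2 : MemLp (fun k => g k * ψ k x) 2 (volume.restrict Q) := by
      refine ⟨hmeas.aestronglyMeasurable, ?_⟩
      rw [eLpNorm_lt_top_iff_lintegral_rpow_enorm_lt_top (by norm_num) (by norm_num)]
      simp only [ENNReal.toReal_ofNat, ENNReal.rpow_ofNat]
      exact (setLIntegral_le_lintegral _ _).trans_lt (lt_top_iff_ne_top.2 hfin)
    have hB := tsum_enorm_integral_sq_le hem he1 horth hL2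
    have h1 : ∀ γ : Γ, ‖∫ k, conj (g k * ψ k (-γ +ᵥ x))‖ₑ =
        ‖∫ k in Q, conj (e (-γ) k)* (g k * ψ k x)‖ₑ := by
      intro γ
      rw [setIntegral_eq_integral_of_forall_compl_eq_zero fun k hk => by simp [hgQ k hk],
        integral_conj, RCLike.enorm_conj]
      congr 1
      refine integral_congr_ae (Eventually.of_forall fun k => ?_)
      simp only
      rw [heconj, AddSubgroup.vadd_def, vadd_eq_add, add_comm, hψ.add_lattice (-γ).2]
      ring
    simp only [h1]
    refine ((Equiv.neg Γ).tsum_eq fun γ =>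
      ‖∫ k in Q, conj (e γ k) * (g k * ψ k x)‖ₑ ^ 2).trans_le (hB.trans ?_)
    rw [Measure.restrict_apply_univ]
    exact mul_le_mul' le_self_add (setLIntegral_le_lintegral _ _)
  have hmeasP : Measurable fun x => ‖∫ k, conj (g k * ψ k x)‖ₑ ^ 2 :=
    (hψ.aestronglyMeasurable_packet hg).enorm.pow_const 2
  have hmeasT : ∀ γ : Γ, AEMeasurable (fun x => ‖∫ k, conj (g k * ψ k (-γ +ᵥ x))‖ₑ ^ 2)
      (volume.restrict (ZSpan.fundamentalDomain b)) := fun γ =>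
    (hmeasP.comp (measurable_const_vadd (-γ))).aemeasurable
  rw [(ZSpan.isAddFundamentalDomain' b volume).lintegral_eq_tsum', ← lintegral_tsum hmeasT]
  refine (lintegral_mono hpt).trans ?_
  have hmeas2 : Measurable fun z : Sp d × Sp d => ‖g z.1 * ψ z.1 z.2‖ₑ ^ 2 :=
    (hψ.measurable_mul hg).enorm.pow_const 2
  -- Tonelli puts the integral over the cell inside, at fixed `k`, where it is bounded by `C`.
  have hswap := lintegral_lintegral_swap (μ := volume.restrict (ZSpan.fundamentalDomain b))
    (ν := volume) (f := fun x k => ‖g k * ψ k x‖ₑ ^ 2)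
    (hmeas2.comp measurable_swap).aemeasurable
  rw [lintegral_const_mul _ hmeas2.lintegral_prod_left', hswap, mul_assoc]
  refine mul_le_mul_right ?_ _
  rw [← lintegral_const_mul _ (hg.enorm.pow_const 2)]
  refine lintegral_mono fun k => ?_
  simp only [enorm_mul, mul_pow]
  rw [lintegral_const_mul _ ((hψ.measurable_apply k).enorm.pow_const 2), mul_comm C]
  exact mul_le_mul_right (hψ.lintegral_cell_le k) _

end IsBand

/-! ### Wave packets as vectors of `L²`: bounds, antilinearity and inner products -/

namespace IsBand

variable {d : ℕ} {b : Module.Basis (Fin d) ℝ (Sp d)} {C : ENNReal} {ψ : Sp d → Sp d → ℂ}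

theorem memLp_packet (hψ : IsBand b C ψ) (hC : C ≠ ⊤) {g : Sp d → ℂ} (hg : Continuous g)
    (hgc : HasCompactSupport g) : MemLp (fun x => ∫ k, conj (g k * ψ k x)) 2 := by
  rw [memLp_two_iff_lintegral (hψ.aestronglyMeasurable_packet hg.measurable).aestronglyMeasurable]
  obtain ⟨C', hC', h⟩ := hψ.exists_lintegral_packet_le hC hgc.isCompact.isBounded
  refine (h g hg.measurable fun k hk => image_eq_zero_of_notMem_tsupport hk).trans_lt
    (ENNReal.mul_lt_top hC'.lt_top ?_)
  exact (memLp_two_iff_lintegral hg.aestronglyMeasurable).1 (hg.memLp_of_hasCompactSupport hgc)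

theorem bandPacket_eq (hψ : IsBand b C ψ) (hC : C ≠ ⊤) {g : Sp d → ℂ} (hg : Continuous g)
    (hgc : HasCompactSupport g) : bandPacket ψ g = (hψ.memLp_packet hC hg hgc).toLp _ :=
  dif_pos _

theorem coeFn_bandPacket (hψ : IsBand b C ψ) (hC : C ≠ ⊤) {g : Sp d → ℂ} (hg : Continuous g)
    (hgc : HasCompactSupport g) :
    bandPacket ψ g =ᵐ[volume] fun x => ∫ k, conj (g k * ψ k x) := by
  rw [hψ.bandPacket_eq hC hg hgc]
  exact MemLp.coeFn_toLp _

/-- A bound by the supremum of `g`, uniform over smearing functions supported in one compact set: it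
turns pointwise Taylor estimates in `k` into norm estimates of packets. -/
theorem exists_norm_bandPacket_le (hψ : IsBand b C ψ) (hC : C ≠ ⊤) {S : Set (Sp d)}
    (hS : IsCompact S) :
    ∃ B : ℝ, 0 ≤ B ∧ ∀ g : Sp d → ℂ, Continuous g → (∀ k ∉ S, g k = 0) →
      ∀ c : ℝ, 0 ≤ c → (∀ k, ‖g k‖ ≤ c) → ‖bandPacket ψ g‖ ≤ B * c := by
  obtain ⟨C', hC', h⟩ := hψ.exists_lintegral_packet_le hC hS.isBounded
  refine ⟨Real.sqrt (C' * volume S).toReal, Real.sqrt_nonneg _, fun g hg hgS c hc hgc => ?_⟩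
  have hcs : HasCompactSupport g := HasCompactSupport.intro hS hgS
  have h1 := h g hg.measurable hgS
  rw [← enorm_toLp_sq (hψ.memLp_packet hC hg hcs), ← hψ.bandPacket_eq hC hg hcs] at h1
  have h2 : ∫⁻ k, ‖g k‖ₑ ^ 2 ≤ volume S * ENNReal.ofReal c ^ 2 := by
    rw [← setLIntegral_eq_of_support_subset (s := S) (by
      intro k hk
      by_contra hkS
      exact hk (by simp [hgS k hkS])), mul_comm, ← setLIntegral_const]
    refine lintegral_mono fun k => ?_
    rw [← ofReal_norm]
    exact pow_le_pow_left' (ENNReal.ofReal_le_ofReal (hgc k)) 2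
  have h3 : ‖bandPacket ψ g‖ₑ ^ 2 ≤ C' * volume S * ENNReal.ofReal c ^ 2 := by
    rw [mul_assoc]
    exact h1.trans (mul_le_mul_right h2 _)
  have hfin : C' * volume S ≠ ⊤ := ENNReal.mul_ne_top hC' hS.measure_lt_top.ne
  have h4 : ‖bandPacket ψ g‖ ^ 2 ≤ (C' * volume S).toReal * c ^ 2 := by
    have := ENNReal.toReal_mono
      (ENNReal.mul_ne_top hfin (ENNReal.pow_ne_top ENNReal.ofReal_ne_top)) h3
    simpa [ENNReal.toReal_mul, ENNReal.toReal_ofReal hc] using this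
  refine le_of_sq_le_sq ?_ (by positivity)
  rwa [mul_pow, Real.sq_sqrt ENNReal.toReal_nonneg]

/-- Justifies Fubini: on `tsupport g ×ˢ T`, of finite measure, `ψ` and `w` are both square
integrable, and `g` is bounded. -/
theorem integrable_prod (hψ : IsBand b C ψ) (hC : C ≠ ⊤) {g : Sp d → ℂ} (hg : Continuous g)
    (hgc : HasCompactSupport g) {w : Sp d → ℂ} (hw : MemLp w 2) {T : Set (Sp d)}
    (hT : MeasurableSet T) (hTb : Bornology.IsBounded T) (hwT : ∀ x ∉ T, w x = 0) :
    Integrable (fun z : Sp d × Sp d => g z.1 * ψ z.1 z.2 * w z.2) := by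
  set S := tsupport g
  have hS : IsCompact S := hgc.isCompact
  obtain ⟨C', hC', hC'ψ⟩ := hψ.exists_lintegral_le hC hT hTb
  have : IsFiniteMeasure (volume.restrict S) := ⟨by simpa using hS.measure_lt_top⟩
  have : IsFiniteMeasure (volume.restrict T) := ⟨by simpa using hTb.measure_lt_top⟩
  have h1 : MemLp (fun z : Sp d × Sp d => ψ z.1 z.2) 2
      ((volume.restrict S).prod (volume.restrict T)) := by
    refine (memLp_two_iff_lintegral hψ.measurable.aestronglyMeasurable).2 ?_
    rw [lintegral_prod _ (hψ.measurable.enorm.pow_const 2).aemeasurable]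
    refine (lintegral_mono fun k => hC'ψ k).trans_lt ?_
    rw [lintegral_const]
    exact ENNReal.mul_lt_top hC'.lt_top (measure_lt_top _ _)
  have h2 : MemLp (fun z : Sp d × Sp d => w z.2) 2
      ((volume.restrict S).prod (volume.restrict T)) := hw.restrict T |>.comp_snd _
  obtain ⟨c, hc⟩ := hg.bounded_above_of_compact_support hgc
  have h3 : Integrable (fun z : Sp d × Sp d => g z.1 * (ψ z.1 z.2 * w z.2))
      ((volume.restrict S).prod (volume.restrict T)) :=
    (h1.integrable_mul h2).bdd_mul (hg.comp continuous_fst).aestronglyMeasurable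
      (Eventually.of_forall fun z => hc z.1)
  rw [Measure.prod_restrict] at h3
  refine IntegrableOn.integrable_of_forall_notMem_eq_zero
    (s := S ×ˢ T) (by simpa only [mul_assoc] using! h3) fun z hz => ?_
  rw [Set.mem_prod, not_and_or] at hz
  rcases hz with hz | hz
  · simp [image_eq_zero_of_notMem_tsupport hz]
  · simp [hwT _ hz]

/-- Additivity of packets needs genuine integrability in `k`. It follows from `integrable_prod` with
indicators of balls, which exhaust space along a sequence. -/
theorem ae_integrable (hψ : IsBand b C ψ) (hC : C ≠ ⊤) {g : Sp d → ℂ} (hg : Continuous g)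
    (hgc : HasCompactSupport g) : ∀ᵐ x, Integrable fun k => g k * ψ k x := by
  have h1 : ∀ n : ℕ, ∀ᵐ x, Integrable fun k => g k * ψ k x *
      (Metric.ball (0 : Sp d) n).indicator (fun _ => (1 : ℂ)) x := by
    intro n
    have hw : MemLp ((Metric.ball (0 : Sp d) n).indicator fun _ => (1 : ℂ)) 2 volume :=
      memLp_indicator_const 2 measurableSet_ball 1 (Or.inr measure_ball_lt_top.ne)
    exact (hψ.integrable_prod hC hg hgc hw measurableSet_ball Metric.isBounded_ball
      fun x hx => Set.indicator_of_notMem hx _).prod_left_ae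
  filter_upwards [ae_all_iff.2 h1] with x hx
  obtain ⟨n, hn⟩ := exists_nat_gt ‖x‖
  have h2 := hx n
  rw [Set.indicator_of_mem (by simpa using hn)] at h2
  simpa using h2

theorem bandPacket_add (hψ : IsBand b C ψ) (hC : C ≠ ⊤) {g h : Sp d → ℂ} (hg : Continuous g)
    (hgc : HasCompactSupport g) (hh : Continuous h) (hhc : HasCompactSupport h) :
    bandPacket ψ (fun k => g k + h k) = bandPacket ψ g + bandPacket ψ h := by
  refine Lp.ext ?_
  filter_upwards [hψ.coeFn_bandPacket hC (hg.add hh) (hgc.add hhc), hψ.coeFn_bandPacket hC hg hgc,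
    hψ.coeFn_bandPacket hC hh hhc, Lp.coeFn_add (bandPacket ψ g) (bandPacket ψ h),
    hψ.ae_integrable hC hg hgc, hψ.ae_integrable hC hh hhc] with x h1 h2 h3 h4 h5 h6
  rw [h4, Pi.add_apply, h2, h3]
  refine h1.trans ?_
  rw [integral_conj, integral_conj, integral_conj, ← map_add,
    ← integral_add h5 h6]
  simp only [Pi.add_apply, add_mul]

theorem bandPacket_smul (hψ : IsBand b C ψ) (hC : C ≠ ⊤) {g : Sp d → ℂ} (hg : Continuous g)
    (hgc : HasCompactSupport g) (c : ℂ) :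
    bandPacket ψ (fun k => c * g k) = conj c • bandPacket ψ g := by
  refine Lp.ext ?_
  filter_upwards [hψ.coeFn_bandPacket hC ((continuous_const (y := c)).mul hg) hgc.mul_left,
    hψ.coeFn_bandPacket hC hg hgc, Lp.coeFn_smul (conj c) (bandPacket ψ g)] with x h1 h2 h3
  rw [h3, Pi.smul_apply, h2]
  refine h1.trans ?_
  rw [smul_eq_mul, ← integral_const_mul]
  simp only [Pi.mul_apply, map_mul, mul_assoc]

/-- Moves a pairing with `χ` or `(-Δ + U)χ` onto the single Bloch functions, where the eigenvalue
equation applies. The conjugation in the packet cancels that of the inner product. -/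
theorem inner_bandPacket (hψ : IsBand b C ψ) (hC : C ≠ ⊤) {g : Sp d → ℂ} (hg : Continuous g)
    (hgc : HasCompactSupport g) {f : OneParticle d} {w : Sp d → ℂ} (hfw : f =ᵐ[volume] w)
    {T : Set (Sp d)} (hT : MeasurableSet T) (hTb : Bornology.IsBounded T)
    (hwT : ∀ x ∉ T, w x = 0) :
    inner ℂ (bandPacket ψ g) f = ∫ k, g k * ∫ x, ψ k x * w x := by
  have hw : MemLp w 2 := (memLp_congr_ae hfw).1 (Lp.memLp f)
  have hint := hψ.integrable_prod hC hg hgc hw hT hTb hwT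
  have h1 : inner ℂ (bandPacket ψ g) f = ∫ x, ∫ k, g k * ψ k x * w x := by
    rw [L2.inner_def]
    refine integral_congr_ae ?_
    filter_upwards [hfw, hψ.coeFn_bandPacket hC hg hgc] with x h1 h2
    rw [h1, h2, RCLike.inner_apply, integral_conj, RCLike.conj_conj, mul_comm,
      ← integral_mul_const]
  rw [h1, ← integral_integral_swap (f := fun k x => g k * ψ k x * w x) hint]
  simp only [mul_assoc, integral_const_mul]

end IsBand

/-! ### Time evolution of wave packets -/

section Schrodinger

variable {d : ℕ} {U : Sp d → ℝ}

theorem schrodinger_eq_zero {χ : Sp d → ℂ} {x : Sp d} (hx : x ∉ tsupport χ) :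
    schrodinger U χ x = 0 := by
  have h0 : χ =ᶠ[𝓝 x] fun _ => 0 := notMem_tsupport_iff_eventuallyEq.1 hx
  have h1 : (Δ χ) x = 0 := by
    rw [(InnerProductSpace.laplacian_congr_nhds h0).eq_of_nhds]
    simp
  rw [schrodinger, h1, h0.eq_of_nhds]
  simp

theorem memLp_schrodinger {b : Module.Basis (Fin d) ℝ (Sp d)} (hU : IsPeriodicPotential b U)
    {χ : Sp d → ℂ} (hχ : ContDiff ℝ ∞ χ) (hχc : HasCompactSupport χ) :
    MemLp (schrodinger U χ) 2 := by
  have hΔ : Continuous (Δ χ) := by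
    rw [InnerProductSpace.laplacian_eq_iteratedFDeriv_stdOrthonormalBasis]
    have h1 : Continuous (iteratedFDeriv ℝ 2 χ) :=
      hχ.continuous_iteratedFDeriv (m := 2) (by exact WithTop.coe_le_coe.2 le_top)
    exact continuous_finsetSum _ fun i _ => by fun_prop
  have hΔc : HasCompactSupport (Δ χ) := by
    refine HasCompactSupport.intro hχc.isCompact fun x hx => ?_
    have h0 : χ =ᶠ[𝓝 x] fun _ => 0 := notMem_tsupport_iff_eventuallyEq.1 hx
    rw [(InnerProductSpace.laplacian_congr_nhds h0).eq_of_nhds]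
    simp
  refine (hΔ.memLp_of_hasCompactSupport hΔc).neg.add ?_
  have hm : AEStronglyMeasurable (fun x => (U x : ℂ) * χ x) volume :=
    ((Complex.measurable_ofReal.comp hU.measurable).mul hχ.continuous.measurable).aestronglyMeasurable
  rw [memLp_two_iff_integrable_sq_norm hm]
  have h2 : Integrable fun x => (‖χ x‖ ^ 2) • (U x ^ 2) :=
    hU.locallyL2.integrable_smul_left_of_hasCompactSupport (by
      have := hχ.continuous
      fun_prop) (by
        refine HasCompactSupport.intro hχc.isCompact fun x hx => ?_
        simp [image_eq_zero_of_notMem_tsupport hx])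
  refine h2.congr (Eventually.of_forall fun x => ?_)
  simp only [smul_eq_mul, norm_mul, Complex.norm_real, Real.norm_eq_abs, mul_pow, sq_abs]
  ring

/-- Every real test function is the first component of a pair in the graph, since `(-Δ + U)χ` lies
in `L²`; and test functions separate locally integrable functions. -/
theorem eq_zero_of_inner_schrodingerGraph {b : Module.Basis (Fin d) ℝ (Sp d)}
    (hU : IsPeriodicPotential b U) {u : OneParticle d}
    (h : ∀ p ∈ schrodingerGraph U, inner ℂ p.1 u = 0) : u = 0 := by
  have hloc : LocallyIntegrable u volume := (Lp.memLp u).locallyIntegrable (by norm_num)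
  have h1 := ae_eq_zero_of_integral_contDiff_smul_eq_zero (f := (u : Sp d → ℂ)) hloc
    fun g hg hgc => by
      have hχ : ContDiff ℝ ∞ fun x => (g x : ℂ) := Complex.ofRealCLM.contDiff.comp hg
      have hχc : HasCompactSupport fun x => (g x : ℂ) :=
        hgc.comp_left (g := fun r : ℝ => (r : ℂ)) Complex.ofReal_zero
      have hL := hχ.continuous.memLp_of_hasCompactSupport (μ := volume) (p := 2) hχc
      have hS := memLp_schrodinger hU hχ hχc
      have h2 := h (hL.toLp _, hS.toLp _)
        ⟨_, hχ, hχc, hL.coeFn_toLp, hS.coeFn_toLp⟩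
      rw [L2.inner_def] at h2
      rw [← h2]
      refine integral_congr_ae ?_
      filter_upwards [hL.coeFn_toLp] with x hx
      rw [hx, RCLike.inner_apply, Complex.conj_ofReal, Complex.real_smul, mul_comm]
  refine Lp.ext ?_
  filter_upwards [h1, Lp.coeFn_zero ℂ 2 (volume : Measure (Sp d))] with x hx hz
  rw [hx, hz, Pi.zero_apply]

namespace IsSchrodingerGroup

variable {V : ℝ → (OneParticle d ≃ₗᵢ[ℂ] OneParticle d)}

theorem hasDerivAt (hV : IsSchrodingerGroup U V) {f g : OneParticle d}
    (hfg : (f, g) ∈ closure (schrodingerGraph U)) (t : ℝ) :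
    HasDerivAt (fun τ => V τ f) (Complex.I • V t g) t := by
  have h1 : HasDerivAt (fun τ => V τ f) (Complex.I • g) (t - t) := by
    rw [sub_self]
    exact (hV.generator f g).2 hfg
  have h2 := ((V t).toContinuousLinearEquiv.toContinuousLinearMap.restrictScalars
    ℝ).hasFDerivAt.comp_hasDerivAt t (h1.comp_sub_const t t)
  have h3 : ∀ τ, V t (V (τ - t) f) = V τ f := fun τ => by
    rw [← hV.add, add_sub_cancel]
  simpa [Function.comp_def, h3] using! h2

theorem mem_closure (hV : IsSchrodingerGroup U V) {f g : OneParticle d}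
    (hfg : (f, g) ∈ closure (schrodingerGraph U)) (t : ℝ) :
    (V t f, V t g) ∈ closure (schrodingerGraph U) := by
  rw [← hV.generator]
  have h1 : HasDerivAt (fun τ => V τ f) (Complex.I • V t g) (0 + t) := by
    rw [zero_add]
    exact hV.hasDerivAt hfg t
  have h2 := h1.comp_add_const 0 t
  simpa only [hV.add] using h2

/-- A differentiable curve that solves the Schrödinger equation weakly is given by the unitary
group. -/
theorem eq_of_hasDerivAt (hV : IsSchrodingerGroup U V) {b : Module.Basis (Fin d) ℝ (Sp d)}
    (hU : IsPeriodicPotential b U) {y z : ℝ → OneParticle d}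
    (hy : ∀ t, HasDerivAt y (Complex.I • z t) t)
    (hz : ∀ t, ∀ p ∈ schrodingerGraph U, inner ℂ (y t) p.2 = inner ℂ (z t) p.1) (t : ℝ) :
    V t (y 0) = y t := by
  -- Evolved pairs need not lie in the graph, only in its closure, so the weak equation is first
  -- extended by continuity.
  have hz' : ∀ t, ∀ p ∈ closure (schrodingerGraph U), inner ℂ (y t) p.2 = inner ℂ (z t) p.1 := by
    intro t
    exact closure_minimal (fun p hp => hz t p hp)
      (isClosed_eq (continuous_const.inner continuous_snd)
        (continuous_const.inner continuous_fst))
  have hconst : ∀ p ∈ schrodingerGraph U, inner ℂ (V t p.1) (y t) = inner ℂ p.1 (y 0) := by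
    intro p hp
    have hpc : (p.1, p.2) ∈ closure (schrodingerGraph U) := subset_closure hp
    -- The two terms of the product rule carry the factors `conj I` and `I`, and cancel by the weak
    -- equation for the evolved pair.
    have hd : ∀ τ, HasDerivAt (fun τ => inner ℂ (V τ p.1) (y τ)) 0 τ := by
      intro τ
      have h1 := (hV.hasDerivAt hpc τ).inner ℂ (hy τ)
      have h2 := hz' τ _ (hV.mem_closure hpc τ)
      have h3 : inner ℂ (V τ p.2) (y τ) = inner ℂ (V τ p.1) (z τ) := by
        rw [← inner_conj_symm, h2, inner_conj_symm]
      rw [inner_smul_left, inner_smul_right, h3, Complex.conj_I] at h1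
      simpa using! h1
    have h4 := is_const_of_deriv_eq_zero (fun τ => (hd τ).differentiableAt)
      (fun τ => (hd τ).deriv) t 0
    simpa only [hV.zero] using h4
  have h5 : (V t).symm (y t) - y 0 = 0 := by
    refine eq_zero_of_inner_schrodingerGraph hU fun p hp => ?_
    rw [inner_sub_right, sub_eq_zero, ← hconst p hp, ← (V t).inner_map_map,
      LinearIsometryEquiv.apply_symm_apply]
  rw [← sub_eq_zero.1 h5, LinearIsometryEquiv.apply_symm_apply]

end IsSchrodingerGroup

end Schrodinger

/-! ### The phases `exp(-itE)` on the packets of one band -/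

section Evolution

variable {d : ℕ} {b : Module.Basis (Fin d) ℝ (Sp d)} {C : ENNReal} {ψ : Sp d → Sp d → ℂ}

theorem norm_exp_neg_I_mul_sub_le (u : ℝ) (hu : |u| ≤ 1) :
    ‖Complex.exp (-Complex.I * u) - 1 + Complex.I * u‖ ≤ u ^ 2 := by
  have h1 : ‖-Complex.I * (u : ℂ)‖ = |u| := by simp
  have h2 := Complex.norm_exp_sub_one_sub_id_le (x := -Complex.I * u) (by rw [h1]; exact hu)
  rw [h1, sq_abs] at h2
  convert h2 using 2
  ring

/-- `E` is bounded on the support of `g`, so the second-order error of the phase is `O(h²)`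
uniformly in `k`. Packets are antilinear in `g`, hence the factor `-iE` appears as `+I` outside. -/
theorem IsBand.hasDerivAt_bandPacket (hψ : IsBand b C ψ) (hC : C ≠ ⊤) {E : Sp d → ℝ}
    (hE : Continuous E) {g : Sp d → ℂ} (hg : Continuous g) (hgc : HasCompactSupport g) (t : ℝ) :
    HasDerivAt (fun τ : ℝ => bandPacket ψ fun k => Complex.exp (-Complex.I * (τ * E k : ℝ)) * g k)
      (Complex.I • bandPacket ψ fun k =>
        E k * (Complex.exp (-Complex.I * (t * E k : ℝ)) * g k)) t := by
  let G : ℝ → Sp d → ℂ := fun τ k => Complex.exp (-Complex.I * (τ * E k : ℝ)) * g k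
  have hGc : ∀ τ, Continuous (G τ) := fun τ => by fun_prop
  have hGs : ∀ τ, HasCompactSupport (G τ) := fun τ => hgc.mul_left
  let G' : Sp d → ℂ := fun k => E k * G t k
  have hG'c : Continuous G' := by fun_prop
  have hG's : HasCompactSupport G' := (hGs t).mul_left
  obtain ⟨B, hB, hbound⟩ := hψ.exists_norm_bandPacket_le hC hgc.isCompact
  obtain ⟨cE, hcE⟩ := hgc.isCompact.exists_bound_of_continuousOn hE.continuousOn
  obtain ⟨cg, hcg⟩ := hg.bounded_above_of_compact_support hgc
  have hcg0 : 0 ≤ cg := (norm_nonneg _).trans (hcg 0)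
  rw [hasDerivAt_iff_isLittleO_nhds_zero]
  refine Asymptotics.IsBigO.trans_isLittleO (g := fun h : ℝ => h ^ 2) ?_ ?_
  · refine Asymptotics.IsBigO.of_bound (B * (cE ^ 2 * cg)) ?_
    have hsmall : ∀ᶠ h : ℝ in 𝓝 0, |h| * |cE| < 1 := by
      have : Tendsto (fun h : ℝ => |h| * |cE|) (𝓝 0) (𝓝 (|0| * |cE|)) :=
        (continuous_abs.mul continuous_const).tendsto 0
      rw [abs_zero, zero_mul] at this
      exact this.eventually_lt_const one_pos
    filter_upwards [hsmall] with h hh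
    have hdiff : bandPacket ψ (G (t + h)) - bandPacket ψ (G t) -
        h • Complex.I • bandPacket ψ G' =
        bandPacket ψ fun k => G (t + h) k + (-1 * G t k + (Complex.I * h) * G' k) := by
      have hs1 : HasCompactSupport fun k => -1 * G t k := (hGs t).mul_left
      have hs2 : HasCompactSupport fun k => (Complex.I * h) * G' k := hG's.mul_left
      rw [hψ.bandPacket_add hC (h := fun k => -1 * G t k + (Complex.I * h) * G' k) (hGc _) (hGs _)
          (by fun_prop) (hs1.add hs2),
        hψ.bandPacket_add hC (by fun_prop) hs1 (by fun_prop) hs2,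
        hψ.bandPacket_smul hC (hGc t) (hGs t), hψ.bandPacket_smul hC hG'c hG's]
      simp only [map_neg, map_one, map_mul, Complex.conj_I, Complex.conj_ofReal, neg_smul, one_smul,
        neg_mul]
      rw [mul_comm Complex.I, mul_smul, Complex.coe_smul]
      abel
    have hnorm : ∀ k, ‖G (t + h) k + (-1 * G t k + (Complex.I * h) * G' k)‖ ≤
        h ^ 2 * (cE ^ 2 * cg) := by
      intro k
      by_cases hk : k ∈ tsupport g
      · have hEk : |E k| ≤ cE := hcE k hk
        have hu : |h * E k| ≤ 1 := by
          rw [abs_mul]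
          refine (mul_le_mul_of_nonneg_left (hEk.trans (le_abs_self cE)) (abs_nonneg h)).trans hh.le
        have h1 : G (t + h) k + (-1 * G t k + (Complex.I * h) * G' k) =
            (Complex.exp (-Complex.I * (h * E k : ℝ)) - 1 + Complex.I * (h * E k : ℝ)) * G t k := by
          simp only [G, G']
          rw [add_mul, Complex.ofReal_add, mul_add, Complex.exp_add]
          push_cast
          ring
        have h2 : ‖G t k‖ = ‖g k‖ := by
          simp only [G, norm_mul]
          rw [show -Complex.I * ((t * E k : ℝ) : ℂ) = ((-(t * E k) : ℝ) : ℂ) * Complex.I by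
            push_cast; ring, Complex.norm_exp_ofReal_mul_I, one_mul]
        rw [h1, norm_mul, h2]
        calc _ ≤ (h * E k) ^ 2 * cg :=
              mul_le_mul (norm_exp_neg_I_mul_sub_le _ hu) (hcg k) (norm_nonneg _) (sq_nonneg _)
          _ = h ^ 2 * (E k ^ 2 * cg) := by ring
          _ ≤ _ := by
              have : E k ^ 2 ≤ cE ^ 2 := sq_le_sq' (neg_le_of_abs_le hEk) (le_of_abs_le hEk)
              gcongr
      · have : g k = 0 := image_eq_zero_of_notMem_tsupport hk
        simp only [G, G', this, mul_zero, add_zero, norm_zero]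
        positivity
    refine (congrArg norm hdiff).trans_le ((hbound _ (by fun_prop) (fun k hk => ?_) _ (by positivity)
      hnorm).trans (le_of_eq ?_))
    · simp [G, G', image_eq_zero_of_notMem_tsupport hk]
    · rw [Real.norm_of_nonneg (sq_nonneg h)]
      ring
  · simpa using Asymptotics.isLittleO_pow_pow (𝕜 := ℝ) (show 1 < 2 by norm_num)

/-- Wave packets of a band evolve by the phases `exp(-itE)`. -/
theorem IsBlochSystem.map_bandPacket {U : Sp d → ℝ} (hU : IsPeriodicPotential b U)
    {V : ℝ → (OneParticle d ≃ₗᵢ[ℂ] OneParticle d)} (hV : IsSchrodingerGroup U V) {N : ℝ}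
    {ψ : ℕ → Sp d → Sp d → ℂ} {E : ℕ → Sp d → ℝ} (hψ : IsBlochSystem b U N ψ E) (n : ℕ)
    {Ω : Set (Sp d)} (hΩ : IsOpen Ω) (hE : ContDiffOn ℝ ∞ (E n) Ω) {g : Sp d → ℂ}
    (hg : Continuous g) (hgc : HasCompactSupport g) (hgΩ : tsupport g ⊆ Ω) (t : ℝ) :
    V t (bandPacket (ψ n) g) =
      bandPacket (ψ n) fun k => Complex.exp (-Complex.I * (t * E n k : ℝ)) * g k := by
  have hb := hψ.isBand n
  -- `E n` is smooth only on `Ω`; where `g ≠ 0` it agrees with a globally smooth `E'`, so the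
  -- packets are the same.
  obtain ⟨E', hE', heq⟩ :=
    exists_contDiff_eventuallyEq_of_isCompact hΩ hE hgc.isCompact hgΩ
  have hEE : ∀ k, g k ≠ 0 → E' k = E n k := fun k hk =>
    heq.self_of_nhdsSet k (subset_tsupport g hk)
  have h1 := hV.eq_of_hasDerivAt hU
    (fun τ => hb.hasDerivAt_bandPacket ENNReal.ofReal_ne_top hE'.continuous hg hgc τ)
    (fun τ p hp => ?_) t
  · have h2 : ∀ τ : ℝ, (fun k => Complex.exp (-Complex.I * (τ * E' k : ℝ)) * g k) =
        fun k => Complex.exp (-Complex.I * (τ * E n k : ℝ)) * g k := by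
      intro τ
      funext k
      by_cases hk : g k = 0
      · simp [hk]
      · rw [hEE k hk]
    rw [h2, h2] at h1
    simpa using h1
  · obtain ⟨χ, hχ, hχc, hp1, hp2⟩ := hp
    have hc := hE'.continuous
    have hGs : HasCompactSupport fun k => Complex.exp (-Complex.I * (τ * E' k : ℝ)) * g k :=
      hgc.mul_left
    have hEs : HasCompactSupport fun k =>
        (E' k : ℂ) * (Complex.exp (-Complex.I * (τ * E' k : ℝ)) * g k) := hGs.mul_left
    rw [hb.inner_bandPacket ENNReal.ofReal_ne_top (by fun_prop) hGs hp2
        (isClosed_tsupport χ).measurableSet hχc.isCompact.isBounded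
        (fun x hx => schrodinger_eq_zero hx),
      hb.inner_bandPacket ENNReal.ofReal_ne_top (by fun_prop) hEs hp1
        (isClosed_tsupport χ).measurableSet hχc.isCompact.isBounded
        (fun x hx => image_eq_zero_of_notMem_tsupport hx)]
    refine integral_congr_ae (Eventually.of_forall fun k => ?_)
    simp only
    rw [hψ.eigen n k χ hχ hχc]
    by_cases hk : g k = 0
    · simp [hk]
    · rw [hEE k hk]
      ring

end Evolution

/-! ### The semiclassical change of variables -/

section Semiclassical

variable {d : ℕ} {Ω : TopologicalSpace.Opens (Sp d)}

/-- The change of variables `(p, q) ↦ ((p - q) / ε, (p + q) / 2)`. -/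
def wignerCLM (d : ℕ) (ε : ℝ) : Sp d × Sp d →L[ℝ] Sp d × Sp d :=
  (ε⁻¹ • (ContinuousLinearMap.fst ℝ (Sp d) (Sp d) - ContinuousLinearMap.snd ℝ (Sp d) (Sp d))).prod
    ((2 : ℝ)⁻¹ •
      (ContinuousLinearMap.fst ℝ (Sp d) (Sp d) + ContinuousLinearMap.snd ℝ (Sp d) (Sp d)))

@[simp]
theorem wignerCLM_apply (ε : ℝ) (z : Sp d × Sp d) :
    wignerCLM d ε z = (ε⁻¹ • (z.1 - z.2), (2 : ℝ)⁻¹ • (z.1 + z.2)) := rfl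

/-- The inverse change of variables `(v, k) ↦ (k + εv/2, k - εv/2)`. -/
def wignerInv (ε : ℝ) (z : Sp d × Sp d) : Sp d × Sp d :=
  (z.2 + (ε / 2) • z.1, z.2 + (-ε / 2) • z.1)

theorem continuous_wignerInv (ε : ℝ) : Continuous (wignerInv (d := d) ε) := by
  unfold wignerInv
  fun_prop

theorem wignerInv_wignerCLM {ε : ℝ} (hε : ε ≠ 0) (z : Sp d × Sp d) :
    wignerInv ε (wignerCLM d ε z) = z := by
  rw [wignerInv, wignerCLM_apply]
  refine Prod.ext ?_ ?_
  · simp only [smul_smul]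
    rw [show ε / 2 * ε⁻¹ = 2⁻¹ by field_simp]
    module
  · simp only [smul_smul]
    rw [show -ε / 2 * ε⁻¹ = -2⁻¹ by field_simp]
    module

/-- The image of a compact set under `wignerInv`. -/
def wignerCompact (ε : ℝ) (L : TopologicalSpace.Compacts (Sp d × Sp d)) :
    TopologicalSpace.Compacts (Sp d × Sp d) :=
  L.map (wignerInv ε) (continuous_wignerInv ε)

theorem mem_wignerCompact {ε : ℝ} (hε : ε ≠ 0) {L : TopologicalSpace.Compacts (Sp d × Sp d)}
    {z : Sp d × Sp d} (hz : wignerCLM d ε z ∈ L) : z ∈ wignerCompact ε L :=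
  ⟨_, hz, wignerInv_wignerCLM hε z⟩

/-- For small `ε` the points `k ± εv/2` with `(v, k) ∈ L` stay in `Ω`, so test functions rewritten
in `(p, q)` are supported in `Ω × Ω`. -/
theorem eventually_forall_add_smul_mem (Ω : TopologicalSpace.Opens (Sp d)) {L : Set (Sp d × Sp d)}
    (hL : IsCompact L) (hLΩ : ∀ z ∈ L, z.2 ∈ Ω) :
    ∀ᶠ h : ℝ in 𝓝 0, ∀ z ∈ L, z.2 + (h / 2) • z.1 ∈ Ω := by
  refine hL.eventually_forall_of_forall_eventually fun z hz => ?_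
  have hc : Continuous fun q : ℝ × Sp d × Sp d => q.2.2 + (q.1 / 2) • q.2.1 := by fun_prop
  refine hc.continuousAt.eventually_mem (Ω.isOpen.mem_nhds ?_)
  simpa using hLΩ z hz

theorem evalOn_coe {X : Type*} [NormedAddCommGroup X] [NormedSpace ℝ X]
    {W : TopologicalSpace.Opens X} (K : 𝓓(W, ℂ) →L[ℂ] ℂ) (F : 𝓓(W, ℂ)) : evalOn K F = K F := by
  rw [evalOn, dif_pos ⟨F.contDiff, F.hasCompactSupport, F.tsupport_subset⟩]
  rfl

/-- The rescaled two-point distribution, tested with functions supported in `L`. -/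
theorem exists_pairingCLM (s : ℕ) (K : 𝓓(box Ω Ω, ℂ) →L[ℂ] ℂ) {ε : ℝ} (hε : ε ≠ 0)
    {L : TopologicalSpace.Compacts (Sp d × Sp d)}
    (hL : (wignerCompact ε L : Set (Sp d × Sp d)) ⊆ box Ω Ω) :
    ∃ T : 𝓓_{L}(Sp d × Sp d, ℂ) →L[ℂ] ℂ, ∀ Ψ, (∃ F : 𝓓(box Ω Ω, ℂ),
        (F : Sp d × Sp d → ℂ) = fun z => ((ε : ℂ) ^ d)⁻¹ * Ψ (wignerCLM d ε z)) ∧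
      T Ψ = (ε : ℂ) ^ s * evalOn K fun z => ((ε : ℂ) ^ d)⁻¹ * Ψ (wignerCLM d ε z) := by
  obtain ⟨T, hT⟩ := exists_compCLM (wignerCLM d ε) L (wignerCompact ε L)
    fun z hz => mem_wignerCompact hε hz
  refine ⟨((ε : ℂ) ^ s) • (K ∘L TestFunction.ofSupportedInCLM ℂ hL ∘L (((ε : ℂ) ^ d)⁻¹ • T)),
    fun Ψ => ?_⟩
  have h1 : (TestFunction.ofSupportedInCLM ℂ hL (((ε : ℂ) ^ d)⁻¹ • T Ψ) : Sp d × Sp d → ℂ) =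
      fun z => ((ε : ℂ) ^ d)⁻¹ * Ψ (wignerCLM d ε z) := by
    funext z
    rw [← hT]
    rfl
  -- `h1` exhibits a genuine test function, so `evalOn` does not take its default value 0.
  refine ⟨⟨_, h1⟩, ?_⟩
  rw [← h1, evalOn_coe]
  rfl

theorem bandPairing_toPhase (s : ℕ) (K : 𝓓(box Ω Ω, ℂ) →L[ℂ] ℂ) (ε : ℝ)
    {Φ : Sp d × Sp d → ℂ} (hΦ : ContDiff ℝ ∞ Φ) (hc : HasCompactSupport Φ) :
    bandPairing s K ε (toPhase Φ) =
      (ε : ℂ) ^ s * evalOn K fun z => ((ε : ℂ) ^ d)⁻¹ * Φ (wignerCLM d ε z) := by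
  simp only [bandPairing, positionFourier_toPhase hΦ hc]
  rfl

theorem isPhaseTest_toPhase {L : TopologicalSpace.Compacts (Sp d × Sp d)}
    (hL : ∀ z ∈ L, z.2 ∈ Ω) (Ψ : 𝓓_{L}(Sp d × Sp d, ℂ)) : IsPhaseTest Ω (toPhase Ψ) :=
  isPhaseTest_iff.2 ⟨TestFunction.ofSupportedIn (K := L)
    (fun z hz => ⟨trivial, hL z hz⟩) Ψ, rfl⟩

/-- The functionals of `exists_pairingCLM` converge to the band distribution function. -/
theorem exists_tendsto_pairingCLM (s : ℕ) {K : ℝ → (𝓓(box Ω Ω, ℂ) →L[ℂ] ℂ)}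
    {f : (Sp d → Sp d → ℂ) → ℂ}
    (hf : ∀ φ, IsPhaseTest Ω φ → Tendsto (fun ε => bandPairing s (K ε) ε φ) (𝓝[>] 0) (𝓝 (f φ)))
    (L : TopologicalSpace.Compacts (Sp d × Sp d)) (hL : ∀ z ∈ L, z.2 ∈ Ω) :
    ∃ T : ℝ → 𝓓_{L}(Sp d × Sp d, ℂ) →L[ℂ] ℂ,
      (∀ Ψ : 𝓓_{L}(Sp d × Sp d, ℂ), Tendsto (fun ε => T ε Ψ) (𝓝[>] 0) (𝓝 (f (toPhase Ψ)))) ∧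
      ∀ᶠ ε : ℝ in 𝓝[>] 0, ∀ Ψ : 𝓓_{L}(Sp d × Sp d, ℂ), (∃ F : 𝓓(box Ω Ω, ℂ),
        (F : Sp d × Sp d → ℂ) = fun z => ((ε : ℂ) ^ d)⁻¹ * Ψ (wignerCLM d ε z)) ∧
      T ε Ψ = (ε : ℂ) ^ s * evalOn (K ε) fun z => ((ε : ℂ) ^ d)⁻¹ * Ψ (wignerCLM d ε z) := by
  have hgood : ∀ᶠ ε : ℝ in 𝓝[>] 0, ∃ T : 𝓓_{L}(Sp d × Sp d, ℂ) →L[ℂ] ℂ, ∀ Ψ,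
      (∃ F : 𝓓(box Ω Ω, ℂ),
        (F : Sp d × Sp d → ℂ) = fun z => ((ε : ℂ) ^ d)⁻¹ * Ψ (wignerCLM d ε z)) ∧
      T Ψ = (ε : ℂ) ^ s * evalOn (K ε) fun z => ((ε : ℂ) ^ d)⁻¹ * Ψ (wignerCLM d ε z) := by
    have h1 := eventually_forall_add_smul_mem Ω L.isCompact hL
    have h2 : ∀ᶠ h : ℝ in 𝓝 0, ∀ z ∈ (L : Set (Sp d × Sp d)), z.2 + (-h / 2) • z.1 ∈ Ω := by
      have : Tendsto (fun h : ℝ => -h) (𝓝 0) (𝓝 0) := by simpa using tendsto_neg (0 : ℝ)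
      exact this.eventually h1
    filter_upwards [nhdsWithin_le_nhds h1, nhdsWithin_le_nhds h2, self_mem_nhdsWithin]
      with ε he1 he2 hε
    refine exists_pairingCLM s (K ε) (ne_of_gt hε) ?_
    rintro _ ⟨z, hz, rfl⟩
    exact ⟨he1 z hz, he2 z hz⟩
  -- Only small `ε` matter; for the others `T ε` is arbitrary.
  choose! T hT using fun (ε : ℝ) (h : ∃ T : 𝓓_{L}(Sp d × Sp d, ℂ) →L[ℂ] ℂ, ∀ Ψ,
      (∃ F : 𝓓(box Ω Ω, ℂ),
        (F : Sp d × Sp d → ℂ) = fun z => ((ε : ℂ) ^ d)⁻¹ * Ψ (wignerCLM d ε z)) ∧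
      T Ψ = (ε : ℂ) ^ s * evalOn (K ε) fun z => ((ε : ℂ) ^ d)⁻¹ * Ψ (wignerCLM d ε z)) => h
  refine ⟨T, fun Ψ => ?_, hgood.mono fun ε hε => hT ε hε⟩
  refine (hf _ (isPhaseTest_toPhase hL Ψ)).congr' ?_
  filter_upwards [hgood] with ε hε
  rw [(hT ε hε Ψ).2, bandPairing_toPhase s (K ε) ε Ψ.contDiff Ψ.hasCompactSupport]

/-- The difference quotients of `E` are a smooth family up to `ε = 0`. -/
theorem exists_contDiff_symmetric_quotient {E : Sp d → ℝ} (hE : ContDiffOn ℝ ∞ E Ω)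
    {L : Set (Sp d × Sp d)} (hL : IsCompact L) (hLΩ : ∀ z ∈ L, z.2 ∈ Ω) :
    ∃ G : ℝ × Sp d × Sp d → ℝ, ContDiff ℝ ∞ G ∧
      (∀ z ∈ L, G (0, z) = inner ℝ (∇ E z.2) z.1) ∧
      ∀ᶠ ε : ℝ in 𝓝[>] 0, ∀ z ∈ L,
        ε * G (ε, z) = E (z.2 + (ε / 2) • z.1) - E (z.2 + (-ε / 2) • z.1) := by
  obtain ⟨δ, hδ, hball⟩ := Metric.eventually_nhds_iff_ball.1
    (eventually_forall_add_smul_mem Ω hL hLΩ)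
  -- `M` is a compact subset of `Ω` containing every point at which `E` is evaluated for small `ε`;
  -- there `E` is replaced by a globally smooth `E'`. The symmetric difference `W` vanishes at `ε =
  -- 0`, so Hadamard's lemma divides it by `ε`.
  let M : Set (Sp d) := (fun q : ℝ × Sp d × Sp d => q.2.2 + (q.1 / 2) • q.2.1) ''
    (Metric.closedBall 0 (δ / 2) ×ˢ L)
  have hM : IsCompact M := ((isCompact_closedBall _ _).prod hL).image (by fun_prop)
  have hMmem : ∀ h : ℝ, |h| ≤ δ / 2 → ∀ z ∈ L, z.2 + (h / 2) • z.1 ∈ M := fun h hh z hz =>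
    ⟨(h, z), ⟨by simpa using hh, hz⟩, rfl⟩
  have hMΩ : M ⊆ Ω := by
    rintro _ ⟨⟨h, z⟩, ⟨hh, hz⟩, rfl⟩
    refine hball h ?_ z hz
    rw [mem_closedBall_zero_iff] at hh
    rw [mem_ball_zero_iff]
    linarith
  obtain ⟨E', hE', heq⟩ := exists_contDiff_eventuallyEq_of_isCompact Ω.isOpen hE hM hMΩ
  let W : ℝ × Sp d × Sp d → ℝ := fun q =>
    E' (q.2.2 + (q.1 / 2) • q.2.1) - E' (q.2.2 + (-q.1 / 2) • q.2.1)
  have hW : ContDiff ℝ ∞ W :=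
    (hE'.comp (by fun_prop)).sub (hE'.comp (by fun_prop))
  obtain ⟨G, hG, hquot, hder⟩ := exists_contDiff_difference_quotient hW
  refine ⟨G, hG, fun z hz => ?_, ?_⟩
  · have hz0 : z.2 ∈ M := by simpa using hMmem 0 (by simpa using (half_pos hδ).le) z hz
    have hnear : E' =ᶠ[𝓝 z.2] E := heq.filter_mono (nhds_le_nhdsSet hz0)
    have hgrad : inner ℝ (∇ E z.2) z.1 = fderiv ℝ E' z.2 z.1 := by
      rw [hnear.fderiv_eq, gradient, InnerProductSpace.toDual_symm_apply]
    rw [hgrad]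
    refine (hder z).unique ?_
    have hfd := (hE'.differentiable (by simp) z.2).hasFDerivAt
    have h1 : ∀ c : ℝ, HasDerivAt (fun h : ℝ => E' (z.2 + (c * h) • z.1))
        (c * fderiv ℝ E' z.2 z.1) 0 := by
      intro c
      have h2 : HasDerivAt (fun h : ℝ => z.2 + (c * h) • z.1) (c • z.1) 0 := by
        simpa using (((hasDerivAt_id (0 : ℝ)).const_mul c).smul_const z.1).const_add z.2
      have h3 : HasFDerivAt E' (fderiv ℝ E' z.2) (z.2 + (c * 0) • z.1) := by simpa using hfd
      simpa using! h3.comp_hasDerivAt (0 : ℝ) h2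
    -- Each endpoint contributes half of `v · ∇E(k)`.
    have h4 := (h1 2⁻¹).sub (h1 (-2⁻¹))
    convert h4 using 1
    · funext h
      simp only [W, Pi.sub_apply]
      congr 4 <;> ring
    · ring
  · have hsmall : ∀ᶠ ε in 𝓝[>] (0 : ℝ), ε < δ / 2 :=
      nhdsWithin_le_nhds (eventually_lt_nhds (half_pos hδ))
    filter_upwards [hsmall, self_mem_nhdsWithin] with ε hε hε0 z hz
    have hε0' : 0 < ε := hε0
    have h1 := hquot ε z
    simp only [W, zero_div, neg_zero, zero_smul, sub_self, sub_zero, smul_eq_mul] at h1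
    rw [← h1, heq.self_of_nhdsSet _ (hMmem ε (by rw [abs_of_pos hε0']; exact hε.le) z hz),
      heq.self_of_nhdsSet _ (hMmem (-ε) (by rw [abs_neg, abs_of_pos hε0']; exact hε.le) z hz)]

/-- The two-particle phase `exp(iτ(E(p) - E(q)))`. -/
def pairPhase (E : Sp d → ℝ) (τ : ℝ) (z : Sp d × Sp d) : ℂ :=
  Complex.exp (Complex.I * (τ * (E z.1 - E z.2) : ℝ))

theorem contDiffOn_pairPhase {E : Sp d → ℝ} (hE : ContDiffOn ℝ ∞ E Ω) (τ : ℝ) :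
    ContDiffOn ℝ ∞ (pairPhase E τ) (box Ω Ω) := by
  have h1 : ContDiffOn ℝ ∞ (fun z : Sp d × Sp d => E z.1) (box Ω Ω) :=
    hE.comp contDiff_fst.contDiffOn fun z hz => hz.1
  have h2 : ContDiffOn ℝ ∞ (fun z : Sp d × Sp d => E z.2) (box Ω Ω) :=
    hE.comp contDiff_snd.contDiffOn fun z hz => hz.2
  exact (contDiffOn_const.mul (Complex.ofRealCLM.contDiff.comp_contDiffOn
    (contDiffOn_const.mul (h1.sub h2)))).cexp

/-- The semiclassical limit of the transported distributions. -/
theorem tendsto_bandPairing_transport (s : ℕ) {E : Sp d → ℝ} (hE : ContDiffOn ℝ ∞ E Ω)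
    {K K' : ℝ → (𝓓(box Ω Ω, ℂ) →L[ℂ] ℂ)} {f : (Sp d → Sp d → ℂ) → ℂ}
    (hf : ∀ φ, IsPhaseTest Ω φ → Tendsto (fun ε => bandPairing s (K ε) ε φ) (𝓝[>] 0) (𝓝 (f φ)))
    (t : ℝ) (hK' : ∀ ε F, K' ε F = K ε (mulTest (contDiffOn_pairPhase hE (ε⁻¹ * t)) F))
    {φ : Sp d → Sp d → ℂ} (hφ : IsPhaseTest Ω φ) :
    Tendsto (fun ε => bandPairing s (K' ε) ε φ) (𝓝[>] 0)
      (𝓝 (f fun r k => φ (r + t • ∇ E k) k)) := by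
  obtain ⟨Φ, rfl⟩ := isPhaseTest_iff.1 hφ
  let L : TopologicalSpace.Compacts (Sp d × Sp d) := ⟨tsupport Φ, Φ.hasCompactSupport⟩
  have hL : ∀ z ∈ L, z.2 ∈ Ω := fun z hz => (Φ.tsupport_subset hz).2
  have hΦL : ∀ z ∉ L, Φ z = 0 := fun z hz => image_eq_zero_of_notMem_tsupport hz
  obtain ⟨T, hTlim, hT⟩ := exists_tendsto_pairingCLM s hf L hL
  obtain ⟨G, hG, hG0, hGε⟩ := exists_contDiff_symmetric_quotient hE L.isCompact hL
  -- The phase `pairPhase E (ε⁻¹ * t)` in the variables `(v, k)`: these functions all have support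
  -- in `L` and depend smoothly on `ε`, including at `ε = 0`.
  let W : ℝ × Sp d × Sp d → ℂ := fun q => Complex.exp (Complex.I * (t * G q : ℝ)) * Φ q.2
  have hW : ContDiff ℝ ∞ W :=
    ((contDiff_const.mul (Complex.ofRealCLM.contDiff.comp
      (contDiff_const.mul hG))).cexp).mul (Φ.contDiff.comp contDiff_snd)
  have hWL : ∀ h, ∀ z ∉ L, W (h, z) = 0 := fun h z hz => by simp [W, hΦL z hz]
  -- Functional and argument both vary with `ε`; this is the use of Banach–Steinhaus.
  have hlim := tendsto_apply_of_tendsto_pointwise hTlim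
    (((continuous_slice hW hWL).tendsto 0).mono_left (nhdsWithin_le_nhds (s := Set.Ioi 0)))
  have h0 : toPhase (slice hW hWL 0) = fun r k => toPhase Φ (r + t • ∇ E k) k := by
    funext r k
    rw [toPhase_transport]
    refine toPhase_congr (fun v => ?_) r
    by_cases hz : (v, k) ∈ L
    · simp only [slice_apply, W, hG0 _ hz, transportSymbol]
      push_cast
      ring_nf
    · simp [W, hΦL _ hz]
  rw [h0] at hlim
  refine hlim.congr' ?_
  filter_upwards [hT, hGε, self_mem_nhdsWithin] with ε hε hGε hε0
  have hne : ε ≠ 0 := ne_of_gt hε0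
  let ΦL : 𝓓_{L}(Sp d × Sp d, ℂ) := ⟨Φ, Φ.contDiff, fun z hz => hΦL z hz⟩
  obtain ⟨F, hF⟩ := (hε ΦL).1
  rw [(hε (slice hW hWL ε)).2, bandPairing_toPhase s (K' ε) ε Φ.contDiff Φ.hasCompactSupport]
  have hF' : (F : Sp d × Sp d → ℂ) = fun z => ((ε : ℂ) ^ d)⁻¹ * Φ (wignerCLM d ε z) := hF
  rw [← hF', evalOn_coe, hK', ← evalOn_coe]
  congr 2
  funext z
  rw [mulTest_apply, hF', slice_apply]
  by_cases hz : wignerCLM d ε z ∈ L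
  · have h1 := hGε _ hz
    have h2 := wignerInv_wignerCLM hne z
    have h3 : z.1 = _ := (congrArg Prod.fst h2).symm
    have h4 : z.2 = _ := (congrArg Prod.snd h2).symm
    simp only [wignerInv] at h3 h4
    rw [← h3, ← h4] at h1
    have h5 : t * G (ε, wignerCLM d ε z) = ε⁻¹ * t * (E z.1 - E z.2) := by
      rw [← h1]
      field_simp
    simp only [W, pairPhase]
    rw [h5]
    ring
  · simp only [W, hΦL _ hz, mul_zero]

end Semiclassical

/-! ### Transport of the band distribution function -/

section Transport

variable {d : ℕ} {Ω : TopologicalSpace.Opens (Sp d)}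

/-- A pointwise limit of continuous functionals on a barrelled space is linear and continuous, so
`f` inherits both properties on functions supported in `L`. -/
theorem exists_phaseCLM (s : ℕ) {K : ℝ → (𝓓(box Ω Ω, ℂ) →L[ℂ] ℂ)} {f : (Sp d → Sp d → ℂ) → ℂ}
    (hf : ∀ φ, IsPhaseTest Ω φ → Tendsto (fun ε => bandPairing s (K ε) ε φ) (𝓝[>] 0) (𝓝 (f φ)))
    (L : TopologicalSpace.Compacts (Sp d × Sp d)) (hL : ∀ z ∈ L, z.2 ∈ Ω) :
    ∃ T : 𝓓_{L}(Sp d × Sp d, ℂ) →L[ℂ] ℂ, ∀ Ψ, T Ψ = f (toPhase Ψ) := by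
  obtain ⟨T, hT, -⟩ := exists_tendsto_pairingCLM s hf L hL
  exact ⟨continuousLinearMapOfTendsto T (tendsto_pi_nhds.2 hT), fun Ψ => rfl⟩

/-- The transport equation in the sense of distributions. -/
theorem hasDerivAt_transport (s : ℕ) {E : Sp d → ℝ} (hE : ContDiffOn ℝ ∞ E Ω)
    {K : ℝ → (𝓓(box Ω Ω, ℂ) →L[ℂ] ℂ)} {f : (Sp d → Sp d → ℂ) → ℂ}
    (hf : ∀ φ, IsPhaseTest Ω φ → Tendsto (fun ε => bandPairing s (K ε) ε φ) (𝓝[>] 0) (𝓝 (f φ)))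
    (t : ℝ) {φ : Sp d → Sp d → ℂ} (hφ : IsPhaseTest Ω φ) :
    HasDerivAt (fun τ : ℝ => f fun r k => φ (r + τ • ∇ E k) k)
      (f fun r k => fderiv ℝ (fun r' => φ r' k) (r + t • ∇ E k) (∇ E k)) t := by
  obtain ⟨Φ, rfl⟩ := isPhaseTest_iff.1 hφ
  let L : TopologicalSpace.Compacts (Sp d × Sp d) := ⟨tsupport Φ, Φ.hasCompactSupport⟩
  have hL : ∀ z ∈ L, z.2 ∈ Ω := fun z hz => (Φ.tsupport_subset hz).2
  have hΦL : ∀ z ∉ L, Φ z = 0 := fun z hz => image_eq_zero_of_notMem_tsupport hz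
  obtain ⟨T, hT⟩ := exists_phaseCLM s hf L hL
  obtain ⟨m, hm, hmeq⟩ := exists_contDiff_eventuallyEq_of_isCompact
    (box (⊤ : TopologicalSpace.Opens (Sp d)) Ω).isOpen (contDiffOn_transportSymbol hE) L.isCompact
    Φ.tsupport_subset
  -- The transported test function on the Fourier side. Its time derivative brings down the symbol
  -- `i v·∇E`, which is the derivative in `r` along `∇E`.
  let W : ℝ × Sp d × Sp d → ℂ := fun q => Complex.exp (q.1 * m q.2) * Φ q.2
  let W' : ℝ × Sp d × Sp d → ℂ := fun q => Complex.exp (q.1 * m q.2) * (m q.2 * Φ q.2)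
  have hexp : ContDiff ℝ ∞ fun q : ℝ × Sp d × Sp d => Complex.exp (q.1 * m q.2) :=
    ((Complex.ofRealCLM.contDiff.comp contDiff_fst).mul (hm.comp contDiff_snd)).cexp
  have hW : ContDiff ℝ ∞ W := hexp.mul (Φ.contDiff.comp contDiff_snd)
  have hW' : ContDiff ℝ ∞ W' :=
    hexp.mul ((hm.comp contDiff_snd).mul (Φ.contDiff.comp contDiff_snd))
  have hWL : ∀ h, ∀ z ∉ L, W (h, z) = 0 := fun h z hz => by simp only [W, hΦL z hz, mul_zero]
  have hWL' : ∀ h, ∀ z ∉ L, W' (h, z) = 0 := fun h z hz => by simp only [W', hΦL z hz, mul_zero]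
  have hd : ∀ h z, HasDerivAt (fun h => W (h, z)) (W' (h, z)) h := by
    intro h z
    have h1 : HasDerivAt (fun h : ℝ => (h : ℂ) * m z) (1 * m z) h :=
      (Complex.ofRealCLM.hasDerivAt (x := h)).mul_const (m z)
    refine (h1.cexp.mul_const (Φ z)).congr_deriv ?_
    simp only [W', one_mul, mul_assoc]
  have key := hasDerivAt_apply_slice T hW hWL hW' hWL' hd t
  have hmΦ : ∀ z, z ∉ L ∨ m z = transportSymbol E z := fun z =>
    (em (z ∈ L)).elim (fun hz => Or.inr (hmeq.self_of_nhdsSet z hz)) Or.inl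
  have h1 : ∀ h, toPhase (slice hW hWL h) = fun r k => toPhase Φ (r + h • ∇ E k) k := by
    intro h
    funext r k
    rw [toPhase_transport]
    refine toPhase_congr (fun v => ?_) r
    rcases hmΦ (v, k) with hz | hz
    · simp only [slice_apply, W, hΦL _ hz, mul_zero]
    · simp only [slice_apply, W, hz]
  have h2 : toPhase (slice hW' hWL' t) = fun r k =>
      fderiv ℝ (fun r' => toPhase Φ r' k) (r + t • ∇ E k) (∇ E k) := by
    funext r k
    rw [fderiv_toPhase_gradient E Φ.contDiff.continuous Φ.hasCompactSupport,
      toPhase_transport E (fun z => transportSymbol E z * Φ z)]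
    refine toPhase_congr (fun v => ?_) r
    rcases hmΦ (v, k) with hz | hz
    · simp only [slice_apply, W', hΦL _ hz, mul_zero]
    · simp only [slice_apply, W', hz]
  simpa only [hT, h1, h2] using key

theorem IsPhaseTest.transport {E : Sp d → ℝ} (hE : ContDiffOn ℝ ∞ E Ω) (t : ℝ)
    {φ : Sp d → Sp d → ℂ} (hφ : IsPhaseTest Ω φ) :
    IsPhaseTest Ω fun r k => φ (r + t • ∇ E k) k := by
  obtain ⟨Φ, rfl⟩ := isPhaseTest_iff.1 hφ
  exact isPhaseTest_iff.2 ⟨mulTest (contDiffOn_exp_transportSymbol hE t) Φ,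
    funext fun r => funext fun k => toPhase_transport E Φ t r k⟩

/-! ### The free flow on phase space and the evolved two-point functions -/

/-- The flow is defined for all `k`, also outside `Ω`; the derivative of an arbitrary function is
measurable. -/
theorem measurable_gradient (E : Sp d → ℝ) : Measurable (∇ E) :=
  (InnerProductSpace.toDual ℝ (Sp d)).symm.continuous.measurable.comp (measurable_fderiv ℝ E)

/-- The free flow `(r, k) ↦ (r + w(k), k)`. -/
def shear {w : Sp d → Sp d} (hw : Measurable w) : Sp d × Sp d ≃ᵐ Sp d × Sp d where
  toFun z := (z.1 + w z.2, z.2)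
  invFun z := (z.1 - w z.2, z.2)
  left_inv z := by simp
  right_inv z := by simp
  measurable_toFun := (measurable_fst.add (hw.comp measurable_snd)).prodMk measurable_snd
  measurable_invFun := (measurable_fst.sub (hw.comp measurable_snd)).prodMk measurable_snd

/-- For fixed `k` the flow is a translation. The swaps put `k` first, as base of the skew product.
-/
theorem measurePreserving_shear {w : Sp d → Sp d} (hw : Measurable w) :
    MeasurePreserving (shear hw) := by
  have h1 : MeasurePreserving (fun z : Sp d × Sp d => (z.1, z.2 + w z.1)) :=
    (MeasurePreserving.id volume).skew_product
      (measurable_snd.add (hw.comp measurable_fst))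
      (Eventually.of_forall fun k => (measurePreserving_add_right volume (w k)).map_eq)
  have h2 : MeasurePreserving (Prod.swap : Sp d × Sp d → Sp d × Sp d) :=
    Measure.measurePreserving_swap
  exact h2.comp (h1.comp h2)

theorem IsGivenBy.transport {E : Sp d → ℝ} (hE : ContDiffOn ℝ ∞ E Ω)
    {f : (Sp d → Sp d → ℂ) → ℂ} {u : Sp d → Sp d → ℂ} (hu : IsGivenBy Ω f u) (t : ℝ) :
    IsGivenBy Ω (fun φ => f fun r k => φ (r + t • ∇ E k) k) fun r k => u (r - t • ∇ E k) k := by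
  intro φ hφ
  have hw : Measurable fun k => t • ∇ E k := (measurable_gradient E).const_smul t
  obtain ⟨hint, hval⟩ := hu _ (hφ.transport hE t)
  let H : Sp d × Sp d → ℂ := fun z => u (z.1 - t • ∇ E z.2) z.2 * φ z.1 z.2
  have hH : (fun z : Sp d × Sp d => u z.1 z.2 * φ (z.1 + t • ∇ E z.2) z.2) = H ∘ shear hw := by
    funext z
    simp [H, shear]
  have hmp := measurePreserving_shear hw
  refine ⟨?_, ?_⟩
  · rw [hH, hmp.integrable_comp_emb (shear hw).measurableEmbedding] at hint
    exact hint
  · refine hval.trans ?_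
    rw [hH]
    exact hmp.integral_comp (shear hw).measurableEmbedding H

/-- The transport equation for differentiable functions. -/
theorem hasDerivAt_comp_sub_smul {u : Sp d → ℂ} (hu : Differentiable ℝ u) (w r : Sp d) (t : ℝ) :
    HasDerivAt (fun τ : ℝ => u (r - τ • w)) (-(fderiv ℝ (fun r' => u (r' - t • w)) r w)) t := by
  have h1 : HasDerivAt (fun τ : ℝ => r - τ • w) (-w) t := by
    simpa using ((hasDerivAt_id t).smul_const w).const_sub r
  have h2 := (hu (r - t • w)).hasFDerivAt.comp_hasDerivAt t h1
  rw [fderiv_comp_sub, ← map_neg]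
  exact h2

theorem contDiffOn_phase {E : Sp d → ℝ} (hE : ContDiffOn ℝ ∞ E Ω) (τ : ℝ) :
    ContDiffOn ℝ ∞ (fun k => Complex.exp (-Complex.I * (τ * E k : ℝ))) Ω :=
  (contDiffOn_const.mul
    (Complex.ofRealCLM.contDiff.comp_contDiffOn (contDiffOn_const.mul hE))).cexp

/-- The two-point function at time `τ`. -/
theorem IsTwoPoint.evolve {b : Module.Basis (Fin d) ℝ (Sp d)} {U : Sp d → ℝ}
    (hU : IsPeriodicPotential b U) {V : ℝ → (OneParticle d ≃ₗᵢ[ℂ] OneParticle d)}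
    (hV : IsSchrodingerGroup U V) {N : ℝ} {ψ : ℕ → Sp d → Sp d → ℂ} {E : ℕ → Sp d → ℝ}
    (hψ : IsBlochSystem b U N ψ E) {A : Type*} [Ring A] [StarRing A] [Algebra ℂ A]
    {a : OneParticle d → A} {α : ℝ → (A ≃⋆ₐ[ℂ] A)} (hα : IsQuasiFreeEvolution a V α) (n : ℕ)
    (hE : ContDiffOn ℝ ∞ (E n) Ω) {ρ : A → ℂ} {K K' : 𝓓(box Ω Ω, ℂ) →L[ℂ] ℂ}
    (hK : IsTwoPoint a (ψ n) Ω ρ K) (τ : ℝ)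
    (hK' : ∀ F, K' F = K (mulTest (contDiffOn_pairPhase hE τ) F)) :
    IsTwoPoint a (ψ n) Ω (fun x => ρ (α τ x)) K' := by
  intro g h Φ hΦ
  have hmap : ∀ g : 𝓓(Ω, ℂ), α τ (bandField a (ψ n) g) =
      bandField a (ψ n) (mulTest (contDiffOn_phase hE τ) g) := by
    intro g
    rw [bandField, hα, hψ.map_bandPacket hU hV n Ω.isOpen hE g.contDiff.continuous
      g.hasCompactSupport g.tsupport_subset]
    rfl
  rw [hK']
  beta_reduce
  rw [map_mul, map_star, hmap, hmap]
  -- The creation operator contributes `conj (exp(-iτE(p)))` and the annihilation operator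
  -- `exp(-iτE(q))`; their product is `pairPhase`.
  refine hK _ _ _ fun p q => ?_
  simp only [mulTest_apply, hΦ, pairPhase, map_mul, ← Complex.exp_conj, map_neg, Complex.conj_I,
    Complex.conj_ofReal]
  rw [mul_mul_mul_comm, ← Complex.exp_add]
  push_cast
  ring_nf

theorem IsBandDistribution.evolve {b : Module.Basis (Fin d) ℝ (Sp d)} {U : Sp d → ℝ}
    (hU : IsPeriodicPotential b U) {V : ℝ → (OneParticle d ≃ₗᵢ[ℂ] OneParticle d)}
    (hV : IsSchrodingerGroup U V) {N : ℝ} {ψ : ℕ → Sp d → Sp d → ℂ} {E : ℕ → Sp d → ℝ}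
    (hψ : IsBlochSystem b U N ψ E) {A : Type*} [Ring A] [StarRing A] [Algebra ℂ A]
    {a : OneParticle d → A} {α : ℝ → (A ≃⋆ₐ[ℂ] A)} (hα : IsQuasiFreeEvolution a V α) (n : ℕ)
    (hE : ContDiffOn ℝ ∞ (E n) Ω) {s : ℕ} {ρ : ℝ → A → ℂ} {f : (Sp d → Sp d → ℂ) → ℂ}
    (hf : IsBandDistribution a (ψ n) Ω s ρ f) (t : ℝ) :
    IsBandDistribution a (ψ n) Ω s (fun ε x => ρ ε (α (ε⁻¹ * t) x))
      fun φ => f fun r k => φ (r + t • ∇ (E n) k) k := by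
  obtain ⟨K, hK, hlim⟩ := hf
  choose K' hK' using fun ε : ℝ =>
    exists_mul_distribution (contDiffOn_pairPhase hE (ε⁻¹ * t)) (K ε)
  exact ⟨K', fun ε hε => (hK ε hε).evolve hU hV hψ hα n hE _ (hK' ε),
    fun φ hφ => tendsto_bandPairing_transport s hE hlim t hK' hφ⟩

end Transport

end BlochEuler

end

theorem proposition4 {d : ℕ} (b : Module.Basis (Fin d) ℝ (BlochEuler.Sp d))
    (U : BlochEuler.Sp d → ℝ) (hU : BlochEuler.IsPeriodicPotential b U)
    (V : ℝ → (BlochEuler.OneParticle d ≃ₗᵢ[ℂ] BlochEuler.OneParticle d))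
    (hV : BlochEuler.IsSchrodingerGroup U V)
    (N : ℝ) (ψ : ℕ → BlochEuler.Sp d → BlochEuler.Sp d → ℂ) (E : ℕ → BlochEuler.Sp d → ℝ)
    (hψ : BlochEuler.IsBlochSystem b U N ψ E)
    {A : Type*} [Ring A] [StarRing A] [Algebra ℂ A] [StarModule ℂ A]
    (σ : ℤˣ) (a : BlochEuler.OneParticle d → A) (ha : BlochEuler.IsCanonicalField σ a)
    (α : ℝ → (A ≃⋆ₐ[ℂ] A)) (hα : BlochEuler.IsQuasiFreeEvolution a V α)
    (ρ : ℝ → A →ₗ[ℂ] ℂ) (hρ : ∀ ε, 0 < ε → BlochEuler.IsState (ρ ε))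
    (n : ℕ) (Ω : TopologicalSpace.Opens (BlochEuler.Sp d)) (hE : ContDiffOn ℝ ∞ (E n) Ω)
    (s : ℕ) (f : (BlochEuler.Sp d → BlochEuler.Sp d → ℂ) → ℂ)
    (hf : BlochEuler.IsBandDistribution a (ψ n) Ω s (fun ε x => ρ ε x) f) :
    ∃ F : ℝ → (BlochEuler.Sp d → BlochEuler.Sp d → ℂ) → ℂ,
      -- the band distribution function exists at every time
      (∀ t, BlochEuler.IsBandDistribution a (ψ n) Ω s
        (fun ε x => ρ ε (α (ε⁻¹ * t) x)) (F t)) ∧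
      (∀ φ, BlochEuler.IsPhaseTest Ω φ → F 0 φ = f φ) ∧
      -- it is the initial one transported with velocity `∇E`
      (∀ t φ, BlochEuler.IsPhaseTest Ω φ →
        F t φ = f (fun r k => φ (r + t • ∇ (E n) k) k)) ∧
      -- it solves the transport equation in the sense of distributions
      (∀ t φ, BlochEuler.IsPhaseTest Ω φ →
        HasDerivAt (fun τ => F τ φ)
          (F t (fun r k => fderiv ℝ (fun r' => φ r' k) r (∇ (E n) k))) t) ∧
      -- if it is initially given by a function, then so it is at all times
      (∀ u : BlochEuler.Sp d → BlochEuler.Sp d → ℂ, BlochEuler.IsGivenBy Ω f u →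
        (∀ t : ℝ, BlochEuler.IsGivenBy Ω (F t) (fun r k => u (r - t • ∇ (E n) k) k)) ∧
        (∀ k ∈ Ω, Differentiable ℝ (fun r => u r k) →
          ∀ (t : ℝ) (r : BlochEuler.Sp d),
          HasDerivAt (fun τ => u (r - τ • ∇ (E n) k) k)
            (-(fderiv ℝ (fun r' => u (r' - t • ∇ (E n) k) k) r (∇ (E n) k))) t)) := by
  obtain ⟨K, -, hlim⟩ := id hf
  -- The evolved distribution is defined by the transport formula, so what has to be proved is that
  -- it is the limit for the evolved states.
  refine ⟨fun t φ => f fun r k => φ (r + t • ∇ (E n) k) k, fun t => hf.evolve hU hV hψ hα n hE t,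
    fun φ _ => by simp, fun t φ _ => rfl,
    fun t φ hφ => BlochEuler.hasDerivAt_transport s hE hlim t hφ, fun u hu => ⟨hu.transport hE, ?_⟩⟩
  exact fun k _ hd t r => BlochEuler.hasDerivAt_comp_sub_smul hd (∇ (E n) k) r t
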